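/- An instance of Robust Matroid Center consists of a finite metric space $(X,d)$, weights $w\colon X\to\mathbb{R}_{\ge 0}$, a matroid $M=(X,\mathcal{I})$ given by an independence oracle, and a bound $m\in\mathbb{R}_{\ge 0}$. For $C\subseteq X$ and $r\ge 0$ let $B(C,r)=\bigcup_{u\in C}\{v\in X : d(u,v)\le r\}$. A solution of radius $r\ge 0$ is a set $C\in\mathcal{I}$ with $\sum_{v\in B(C,r)}w(v)\ge m$; the problem asks for a solution of smallest possible radius. Theorem. There is a combinatorial polynomial-time $5$-approximation algorithm for Robust Matroid Center. That is, there are a single deterministic algorithm, which operates on indices with additions, subtractions and comparisons, operates on the real input numbers (the distances, the weights and $m$) only by additions and comparisons, and accesses $M$ only by queries to its independence oracle, and a polynomial $q$, such that on every instance and for every enumeration of $X$ the algorithm halts after at most $q(|X|)$ steps (each elementary operation and each oracle query counting as one step), and: if the instance has a solution, then the algorithm returns a solution $C$ together with a radius $r$ of it such that $r\le 5r'$ whenever the instance has a solution of radius $r'$; if the instance has no solution, then the algorithm reports this. -/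

import Mathlib

open scoped NNReal

/-! ### Robust Matroid Center -/

/-- An instance of Robust Matroid Center on a finite metric space `X`: weights `w`, a matroid `M`
with ground set `X`, and a lower bound `m` on the weight to be clustered. -/
structure RobustMatroidCenter (X : Type*) [Fintype X] [MetricSpace X] where
  /-- the weights of the points -/
  w : X → ℝ≥0
  /-- the matroid on the points -/
  M : Matroid X
  /-- the ground set of the matroid is the whole space -/
  ground_eq : M.E = Set.univ
  /-- the weight that has to be clustered -/
  m : ℝ≥0

namespace RobustMatroidCenter

variable {X : Type*} [Fintype X] [MetricSpace X]

/-- `B(C, r)`: the points at distance at most `r` from some point of `C`. -/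
def cover (C : Set X) (r : ℝ) : Set X := ⋃ u ∈ C, Metric.closedBall u r

/-- `w(U)`: the total weight of a set `U` of points. -/
noncomputable def weight (I : RobustMatroidCenter X) (U : Set X) : ℝ≥0 :=
  ∑ x, U.indicator I.w x

/-- `C` is a solution of radius `r`: it is independent, and the balls of radius `r` around its
points have total weight at least `m`. -/
def IsSolution (I : RobustMatroidCenter X) (C : Set X) (r : ℝ) : Prop :=
  0 ≤ r ∧ I.M.Indep C ∧ I.m ≤ I.weight (cover C r)

end RobustMatroidCenter

/-! ### The machine model

A uniform imperative language over two memories.  One holds natural numbers (indices, counters,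
flags), the other real numbers.  Each memory is a family of zero-initialised two-dimensional arrays
(a scalar is entry `(0, 0)` of an array); a program is a finite text, so it mentions finitely many
of them.  Natural numbers can be added, subtracted (truncated) and compared.  Real numbers can only
be added and compared, so after `t` steps every real number in memory is a combination of the input
numbers with natural coefficients at most `2 ^ t`.  There is no multiplication, hence no number
longer than linearly many bits in the number of steps can be created.  Every operation that is
carried out costs one step, and so does a query to the independence oracle. -/

/-- The memory contents: `nat a i j` and `real a i j` are the entries `(i, j)` of the `a`-th arrays
of natural and of real numbers. -/
structure Memory where
  /-- the arrays of natural numbers -/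
  nat : ℕ → ℕ → ℕ → ℕ
  /-- the arrays of real numbers -/
  real : ℕ → ℕ → ℕ → ℝ

namespace Memory

/-- Write the natural number `v` to entry `(i, j)` of the `a`-th array of natural numbers. -/
def setNat (s : Memory) (a i j v : ℕ) : Memory :=
  { s with nat := fun a' i' j' => if a' = a ∧ i' = i ∧ j' = j then v else s.nat a' i' j' }

/-- Write the real number `v` to entry `(i, j)` of the `a`-th array of real numbers. -/
def setReal (s : Memory) (a i j : ℕ) (v : ℝ) : Memory :=
  { s with real := fun a' i' j' => if a' = a ∧ i' = i ∧ j' = j then v else s.real a' i' j' }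

end Memory

/-- Expressions for natural numbers: literals, array entries, sums and truncated differences. -/
inductive NatExpr where
  | lit (k : ℕ)
  | get (a : ℕ) (i j : NatExpr)
  | add (e f : NatExpr)
  | sub (e f : NatExpr)

namespace NatExpr

/-- The value of an expression. -/
def eval (s : Memory) : NatExpr → ℕ
  | lit k => k
  | get a i j => s.nat a (i.eval s) (j.eval s)
  | add e f => e.eval s + f.eval s
  | sub e f => e.eval s - f.eval s

/-- The number of operations needed to evaluate an expression. -/
def cost : NatExpr → ℕ
  | lit _ => 1
  | get _ i j => i.cost + j.cost + 1
  | add e f => e.cost + f.cost + 1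
  | sub e f => e.cost + f.cost + 1

end NatExpr

/-- Expressions for real numbers: zero, array entries and sums. -/
inductive RealExpr where
  | zero
  | get (a : ℕ) (i j : NatExpr)
  | add (x y : RealExpr)

namespace RealExpr

/-- The value of an expression. -/
def eval (s : Memory) : RealExpr → ℝ
  | zero => 0
  | get a i j => s.real a (i.eval s) (j.eval s)
  | add x y => x.eval s + y.eval s

/-- The number of operations needed to evaluate an expression. -/
def cost : RealExpr → ℕ
  | zero => 1
  | get _ i j => i.cost + j.cost + 1
  | add x y => x.cost + y.cost + 1

end RealExpr

/-- Tests: comparisons of two natural or of two real numbers, and their Boolean combinations. -/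
inductive Test where
  | leNat (e f : NatExpr)
  | leReal (x y : RealExpr)
  | not (b : Test)
  | and (b c : Test)

namespace Test

/-- The test succeeds. -/
def Holds (s : Memory) : Test → Prop
  | leNat e f => e.eval s ≤ f.eval s
  | leReal x y => x.eval s ≤ y.eval s
  | not b => ¬ b.Holds s
  | and b c => b.Holds s ∧ c.Holds s

/-- The number of operations needed to evaluate a test. -/
def cost : Test → ℕ
  | leNat e f => e.cost + f.cost + 1
  | leReal x y => x.cost + y.cost + 1
  | not b => b.cost + 1
  | and b c => b.cost + c.cost + 1

end Test

/-- Programs.  The command `query a b` asks the oracle about the set of all indices `i` for which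
entry `(i, 0)` of array `b` is nonzero, and stores the answer (`1` or `0`) in entry `(0, 0)` of
array `a`. -/
inductive Program where
  | skip
  | setNat (a : ℕ) (i j e : NatExpr)
  | setReal (a : ℕ) (i j : NatExpr) (x : RealExpr)
  | query (a b : ℕ)
  | seq (P Q : Program)
  | ite (b : Test) (P Q : Program)
  | while (b : Test) (P : Program)

/-- `Exec O P s s' t`: started with memory `s` and with access to the oracle `O`, the program `P`
halts after exactly `t` steps with memory `s'`. -/
inductive Exec (O : Set ℕ → Prop) : Program → Memory → Memory → ℕ → Prop
  | skip (s) : Exec O .skip s s 1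
  | setNat (s a) (i j e : NatExpr) :
      Exec O (.setNat a i j e) s (s.setNat a (i.eval s) (j.eval s) (e.eval s))
        (i.cost + j.cost + e.cost + 1)
  | setReal (s a) (i j : NatExpr) (x : RealExpr) :
      Exec O (.setReal a i j x) s (s.setReal a (i.eval s) (j.eval s) (x.eval s))
        (i.cost + j.cost + x.cost + 1)
  | queryYes (s a b) (h : O {i | s.nat b i 0 ≠ 0}) :
      Exec O (.query a b) s (s.setNat a 0 0 1) 1
  | queryNo (s a b) (h : ¬ O {i | s.nat b i 0 ≠ 0}) :
      Exec O (.query a b) s (s.setNat a 0 0 0) 1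
  | seq {P Q s₁ s₂ s₃ t₁ t₂} (h₁ : Exec O P s₁ s₂ t₁) (h₂ : Exec O Q s₂ s₃ t₂) :
      Exec O (.seq P Q) s₁ s₃ (t₁ + t₂)
  | iteTrue {b P Q s s' t} (hb : b.Holds s) (h : Exec O P s s' t) :
      Exec O (.ite b P Q) s s' (b.cost + t)
  | iteFalse {b P Q s s' t} (hb : ¬ b.Holds s) (h : Exec O Q s s' t) :
      Exec O (.ite b P Q) s s' (b.cost + t)
  | whileFalse {b P s} (hb : ¬ b.Holds s) : Exec O (.while b P) s s b.cost
  | whileTrue {b P s₁ s₂ s₃ t₁ t₂} (hb : b.Holds s₁) (h₁ : Exec O P s₁ s₂ t₁)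
      (h₂ : Exec O (.while b P) s₂ s₃ t₂) : Exec O (.while b P) s₁ s₃ (b.cost + t₁ + t₂)

/-- Execution is deterministic: the final memory and the number of steps are unique. -/
theorem Exec.det {O : Set ℕ → Prop} {P : Program} {s s₁ s₂ : Memory} {t₁ t₂ : ℕ}
    (h₁ : Exec O P s s₁ t₁) (h₂ : Exec O P s s₂ t₂) : s₁ = s₂ ∧ t₁ = t₂ := by
  induction h₁ generalizing s₂ t₂ with
  | skip => cases h₂; simp
  | setNat => cases h₂; simp
  | setReal => cases h₂; simp
  | queryYes _ _ _ h => cases h₂ <;> simp_all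
  | queryNo _ _ _ h => cases h₂ <;> simp_all
  | seq _ _ ih ih' =>
    cases h₂ with
    | seq k k' =>
      obtain ⟨rfl, rfl⟩ := ih k
      obtain ⟨rfl, rfl⟩ := ih' k'
      simp
  | iteTrue hb _ ih =>
    cases h₂ with
    | iteTrue _ k => obtain ⟨rfl, rfl⟩ := ih k; simp
    | iteFalse hb' => exact absurd hb hb'
  | iteFalse hb _ ih =>
    cases h₂ with
    | iteTrue hb' => exact absurd hb' hb
    | iteFalse _ k => obtain ⟨rfl, rfl⟩ := ih k; simp
  | whileFalse hb =>
    cases h₂ with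
    | whileFalse => simp
    | whileTrue hb' => exact absurd hb' hb
  | whileTrue hb _ _ ih ih' =>
    cases h₂ with
    | whileFalse hb' => exact absurd hb hb'
    | whileTrue _ k k' =>
      obtain ⟨rfl, rfl⟩ := ih k
      obtain ⟨rfl, rfl⟩ := ih' k'
      simp

/-! ### Input, oracle and output

The points are presented to the machine as `0, …, n - 1` through an arbitrary enumeration `e`. -/

namespace RobustMatroidCenter

variable {X : Type*} [Fintype X] [MetricSpace X]

/-- The independence oracle: a set of indices is answered with yes if and only if the corresponding
set of points is independent. -/
def oracle (I : RobustMatroidCenter X) {n : ℕ} (e : Fin n ≃ X) (S : Set ℕ) : Prop :=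
  I.M.Indep {x | (e.symm x : ℕ) ∈ S}

/-- The initial memory: the number `n` of points is in natural array `0`; the distances, the weights
and the bound `m` are in real arrays `0`, `1` and `2`; everything else is zero.  The matroid can
only be accessed through the oracle. -/
noncomputable def input (I : RobustMatroidCenter X) {n : ℕ} (e : Fin n ≃ X) : Memory where
  nat
    | 0, 0, 0 => n
    | _, _, _ => 0
  real
    | 0, i, j => if h : i < n ∧ j < n then dist (e ⟨i, h.1⟩) (e ⟨j, h.2⟩) else 0
    | 1, i, 0 => if h : i < n then I.w (e ⟨i, h⟩) else 0
    | 2, 0, 0 => I.m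
    | _, _, _ => 0

/-- The flag in natural array `1`, by which the machine reports whether it found a solution. -/
def outFlag (s : Memory) : ℕ := s.nat 1 0 0

/-- The set of centers that the machine returns, given by natural array `2`. -/
def outCenters {n : ℕ} (e : Fin n ≃ X) (s : Memory) : Set X := {x | s.nat 2 (e.symm x) 0 ≠ 0}

/-- The radius that the machine returns, in real array `3`. -/
def outRadius (s : Memory) : ℝ := s.real 3 0 0

/-- The final memory `s` holds an `α`-approximate answer: if the instance has a solution (of any
radius), then the flag is `1` and the returned set and radius form a solution whose radius is at
most `α` times the radius of every solution; otherwise the flag is `0`. -/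
def IsApproxAnswer (I : RobustMatroidCenter X) (α : ℝ) {n : ℕ} (e : Fin n ≃ X) (s : Memory) :
    Prop :=
  ((∃ C r, I.IsSolution C r) → outFlag s = 1 ∧ I.IsSolution (outCenters e s) (outRadius s) ∧
    ∀ C r, I.IsSolution C r → outRadius s ≤ α * r) ∧
  ((¬ ∃ C r, I.IsSolution C r) → outFlag s = 0)

end RobustMatroidCenter

/-! Fix a radius `r` for which a solution `C` exists. The algorithm grows a set `S` of points
together with distinct representatives `φ s`, each within `2r` of `s`, that form an independent set.
In each round, among the points `u ∉ S` for which `insert u S` still has such a transversal, it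
picks one whose ball of radius `r` has the largest uncovered weight, and then declares the ball of
radius `3r` around `u` covered. Since `φ s` is within `2r` of `s`, the representatives cover all of
this with radius `5r` (`coverIn_subset_image`).

The greedy rule works because of the invariant `Promising`: some set `O` of points, at first `C`, is
farther than `2r` from `S`, is jointly independent with some transversal of `S`, and its `r`-balls
together with the covered points weigh at least `m`. Let `u` be the next choice. If points of `O`
lie within `2r` of `u`, one of them can represent `u`; all of them are dropped, and their `r`-balls
lie in the `3r`-ball of `u`. If there are none, a matroid exchange (`IsTransversal.exists_erase`)
shows that dropping a single `o` makes room for `u`. This `o` was itself a possible choice, so its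
uncovered weight is at most that of `u`; and the `r`-ball of `u` is disjoint from those of `O`, so
nothing is counted twice (`Promising.insert`). When no point can be added, `O` is empty, as each of
its points could represent itself (`Promising.le_of_maximal`).

Whether `u` can be added is decided in an exchange graph on `insert u S`: `s` points to `t` if some
`x` near `s` is not spanned by the representatives other than `φ t`, and `s` is an exit if some `x`
near `s` is not spanned by all of them. If no exit is reachable from `u`, the reachable nodes have
too small a span for a larger transversal (`IsTransversal.not_of_closed`). Otherwise the first exit
in search order moves, which creates an earlier exit and keeps the list up to it valid
(`IsSearch.exists_exit_update`); eventually `u` itself is an exit and receives a representative.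

The cover of a set changes only when the radius passes a distance, so the radius zero and all
distances are tried and the best result is kept. A result is checked against `m` before it is
accepted, so radii without a solution do no harm. Every loop of the program runs through `0, …, n -
1`, which makes the running time polynomial. -/

/-! ### Programs with bounded loops

Programs in which every loop runs a counter through `0, …, n - 1`, where `n` is the size of the
input.  They run in polynomial time by construction. -/

/-- Programs with bounded loops.  The command `loop c p` runs `p` with the counter `c` (entry
`(0, 0)` of the natural array `c`) at `0, …, n - 1`. -/
inductive LoopProgram where
  | skip
  | setNat (a : ℕ) (i j e : NatExpr)
  | setReal (a : ℕ) (i j : NatExpr) (x : RealExpr)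
  | query (a b : ℕ)
  | seq (p q : LoopProgram)
  | ite (b : Test) (p q : LoopProgram)
  | loop (c : ℕ) (p : LoopProgram)

infixr:60 " ;; " => LoopProgram.seq

namespace NatExpr

/-- The scalar stored in the array `a`. -/
abbrev var (a : ℕ) : NatExpr := get a (lit 0) (lit 0)

/-- Entry `e` of the one-dimensional array `a`. -/
abbrev entry (a : ℕ) (e : NatExpr) : NatExpr := get a e (lit 0)

end NatExpr

namespace LoopProgram

/-- Assignment to a scalar. -/
abbrev assign (a : ℕ) (e : NatExpr) : LoopProgram := setNat a (.lit 0) (.lit 0) e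

/-- Assignment to a real scalar. -/
abbrev assignReal (a : ℕ) (x : RealExpr) : LoopProgram := setReal a (.lit 0) (.lit 0) x

/-- Assignment to an entry of a one-dimensional array. -/
abbrev store (a : ℕ) (i e : NatExpr) : LoopProgram := setNat a i (.lit 0) e

/-- The test of the loop with counter `c`. -/
def loopTest (c : ℕ) : Test := .leNat (.add (.var c) (.lit 1)) (.var 0)

/-- The increment of the counter `c`. -/
def increment (c : ℕ) : Program := .setNat c (.lit 0) (.lit 0) (.add (.var c) (.lit 1))

/-- Translation into the language of the machine. -/
def compile : LoopProgram → Program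
  | skip => .skip
  | setNat a i j e => .setNat a i j e
  | setReal a i j x => .setReal a i j x
  | query a b => .query a b
  | seq p q => .seq p.compile q.compile
  | ite b p q => .ite b p.compile q.compile
  | loop c p => .seq (.setNat c (.lit 0) (.lit 0) (.lit 0))
      (.while (loopTest c) (.seq p.compile (increment c)))

/-- Run `f` with the counter `c` at `0, …, k - 1`. -/
def iterate (f : Memory → Memory) (c : ℕ) : ℕ → Memory → Memory
  | 0, s => s.setNat c 0 0 0
  | k + 1, s => (f (iterate f c k s)).setNat c 0 0 (k + 1)

open scoped Classical in
/-- The final memory of a run. -/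
noncomputable def run (O : Set ℕ → Prop) : LoopProgram → Memory → Memory
  | skip => fun s => s
  | setNat a i j e => fun s => s.setNat a (i.eval s) (j.eval s) (e.eval s)
  | setReal a i j x => fun s => s.setReal a (i.eval s) (j.eval s) (x.eval s)
  | query a b => fun s => s.setNat a 0 0 (if O {i | s.nat b i 0 ≠ 0} then 1 else 0)
  | seq p q => fun s => q.run O (p.run O s)
  | ite b p q => fun s => if b.Holds s then p.run O s else q.run O s
  | loop c p => fun s => iterate (p.run O) c (s.nat 0 0 0) s

/-- The natural arrays that a program writes. -/
def natWrites : LoopProgram → List ℕ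
  | setNat a _ _ _ => [a]
  | query a _ => [a]
  | seq p q => p.natWrites ++ q.natWrites
  | ite _ p q => p.natWrites ++ q.natWrites
  | loop c p => c :: p.natWrites
  | _ => []

/-- The real arrays that a program writes. -/
def realWrites : LoopProgram → List ℕ
  | setReal a _ _ _ => [a]
  | seq p q => p.realWrites ++ q.realWrites
  | ite _ p q => p.realWrites ++ q.realWrites
  | loop _ p => p.realWrites
  | _ => []

/-- No loop overwrites its counter or the size of the input. -/
def WellFormed : LoopProgram → Bool
  | seq p q => p.WellFormed && q.WellFormed
  | ite _ p q => p.WellFormed && q.WellFormed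
  | loop c p => p.WellFormed && c != 0 && !p.natWrites.contains c && !p.natWrites.contains 0
  | _ => true

/-- A bound on the number of steps, as a polynomial in the size of the input. -/
noncomputable def bound : LoopProgram → Polynomial ℕ
  | skip => 1
  | setNat _ i j e => Polynomial.C (i.cost + j.cost + e.cost + 1)
  | setReal _ i j x => Polynomial.C (i.cost + j.cost + x.cost + 1)
  | query _ _ => 1
  | seq p q => p.bound + q.bound
  | ite b p q => Polynomial.C b.cost + (p.bound + q.bound)
  | loop c p => 4 + Polynomial.C (loopTest c).cost +
      Polynomial.X * (Polynomial.C (loopTest c).cost + p.bound + 8)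

/-- The memories `s` and `s'` agree on the arrays that `p` does not write. -/
structure Agree (p : LoopProgram) (s s' : Memory) : Prop where
  nat : ∀ a, a ∉ p.natWrites → s'.nat a = s.nat a
  real : ∀ a, a ∉ p.realWrites → s'.real a = s.real a

end LoopProgram

namespace Memory

theorem nat_setNat_of_ne (s : Memory) {a b : ℕ} (h : b ≠ a) (i j v : ℕ) :
    (s.setNat a i j v).nat b = s.nat b := by
  funext i' j'; simp [setNat, h]

theorem real_setReal_of_ne (s : Memory) {a b : ℕ} (h : b ≠ a) (i j : ℕ) (v : ℝ) :
    (s.setReal a i j v).real b = s.real b := by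
  funext i' j'; simp [setReal, h]

@[simp] theorem real_setNat (s : Memory) (a i j v : ℕ) : (s.setNat a i j v).real = s.real := rfl

@[simp] theorem nat_setReal (s : Memory) (a i j : ℕ) (v : ℝ) :
    (s.setReal a i j v).nat = s.nat := rfl

theorem nat_setNat (s : Memory) (a b i j i' j' v : ℕ) :
    (s.setNat a i j v).nat b i' j' = if b = a ∧ i' = i ∧ j' = j then v else s.nat b i' j' := rfl

theorem real_setReal (s : Memory) (a b i j i' j' : ℕ) (v : ℝ) :
    (s.setReal a i j v).real b i' j' = if b = a ∧ i' = i ∧ j' = j then v else s.real b i' j' :=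
  rfl

end Memory

/-! ### Bounded loops: frame rule, loop invariants, running time. -/

namespace LoopProgram

variable {O : Set ℕ → Prop}

theorem run_seq (p q : LoopProgram) (s : Memory) :
    (p ;; q).run O s = q.run O (p.run O s) := rfl

theorem run_query_ne_zero {a b : ℕ} {s : Memory} :
    ((query a b).run O s).nat a 0 0 ≠ 0 ↔ O {i | s.nat b i 0 ≠ 0} := by
  simp only [run, Memory.nat_setNat, true_and, if_true]
  split_ifs with h <;> simp [h]

theorem run_ite_pos {b : Test} {p q : LoopProgram} {s : Memory} (h : b.Holds s) :
    (ite b p q).run O s = p.run O s := if_pos h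

theorem run_ite_neg {b : Test} {p q : LoopProgram} {s : Memory} (h : ¬ b.Holds s) :
    (ite b p q).run O s = q.run O s := if_neg h

/-- The frame rule. The lists of written arrays are concrete for each part of the algorithm, so its
side conditions are mostly settled by `decide`. -/
theorem agree_run (p : LoopProgram) (s : Memory) : p.Agree s (p.run O s) := by
  induction p generalizing s with
  | skip => exact ⟨fun _ _ => rfl, fun _ _ => rfl⟩
  | setNat a i j e =>
    refine ⟨fun b hb => s.nat_setNat_of_ne (by simpa [natWrites] using hb) .., fun _ _ => rfl⟩
  | setReal a i j x =>
    refine ⟨fun _ _ => rfl, fun b hb => s.real_setReal_of_ne (by simpa [realWrites] using hb) ..⟩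
  | query a b =>
    refine ⟨fun b hb => s.nat_setNat_of_ne (by simpa [natWrites] using hb) .., fun _ _ => rfl⟩
  | seq p q hp hq =>
    constructor <;> intro a ha <;> simp only [natWrites, realWrites, List.mem_append, not_or] at ha
    · exact ((hq _).nat a ha.2).trans ((hp s).nat a ha.1)
    · exact ((hq _).real a ha.2).trans ((hp s).real a ha.1)
  | ite b p q hp hq =>
    constructor <;> intro a ha <;> simp only [natWrites, realWrites, List.mem_append, not_or] at ha
      <;> simp only [run] <;> split_ifs
    · exact (hp s).nat a ha.1
    · exact (hq s).nat a ha.2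
    · exact (hp s).real a ha.1
    · exact (hq s).real a ha.2
  | loop c p hp =>
    constructor <;> intro a ha <;> simp only [natWrites, realWrites, List.mem_cons, not_or] at ha
      <;> simp only [run] <;> generalize s.nat 0 0 0 = k
    · induction k with
      | zero => exact s.nat_setNat_of_ne ha.1 ..
      | succ k ih =>
        exact (Memory.nat_setNat_of_ne _ ha.1 ..).trans (((hp _).nat a ha.2).trans ih)
    · induction k with
      | zero => rfl
      | succ k ih => exact ((hp _).real a ha).trans ih

theorem nat_run (p : LoopProgram) (s : Memory) (a : ℕ) (h : a ∉ p.natWrites) :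
    (p.run O s).nat a = s.nat a := (agree_run p s).nat a h

theorem real_run (p : LoopProgram) (s : Memory) (a : ℕ) (h : a ∉ p.realWrites) :
    (p.run O s).real a = s.real a := (agree_run p s).real a h

theorem agree_iterate (c : ℕ) (p : LoopProgram) (s : Memory) (k : ℕ) :
    (loop c p).Agree s (iterate (p.run O) c k s) := by
  induction k with
  | zero =>
    refine ⟨fun a ha => ?_, fun a ha => rfl⟩
    simp only [natWrites, List.mem_cons, not_or] at ha
    exact s.nat_setNat_of_ne ha.1 ..
  | succ k ih =>
    refine ⟨fun a ha => ?_, fun a ha => ?_⟩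
    · have ha' := ha
      simp only [natWrites, List.mem_cons, not_or] at ha'
      exact (Memory.nat_setNat_of_ne _ ha'.1 ..).trans ((nat_run p _ a ha'.2).trans (ih.nat a ha))
    · exact (real_run p _ a ha).trans (ih.real a ha)

theorem iterate_counter (f : Memory → Memory) (c k : ℕ) (s : Memory) :
    (iterate f c k s).nat c 0 0 = k := by
  cases k <;> simp [iterate, Memory.nat_setNat]

/-- Loop invariants. -/
theorem run_loop {c : ℕ} {p : LoopProgram} {s : Memory} (motive : ℕ → Memory → Prop) {n : ℕ}
    (hn : s.nat 0 0 0 = n) (zero : motive 0 (s.setNat c 0 0 0))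
    (succ : ∀ i s', i < n → s'.nat c 0 0 = i → (loop c p).Agree s s' → motive i s' →
      motive (i + 1) ((p.run O s').setNat c 0 0 (i + 1))) :
    motive n ((loop c p).run O s) := by
  simp only [run, hn]
  suffices ∀ k ≤ n, motive k (iterate (p.run O) c k s) from this n le_rfl
  intro k hk
  induction k with
  | zero => exact zero
  | succ k ih => exact succ k _ hk (iterate_counter ..) (agree_iterate ..) (ih (by omega))

/-- Here `i` rounds are done and `k` remain; the induction is on `k`. As the body writes neither the
counter nor the size, incrementing the counter agrees with the explicit assignment in `iterate`. -/
theorem exec_while {c : ℕ} {p : LoopProgram} (hc : c ≠ 0) (hc' : c ∉ p.natWrites)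
    (h0 : 0 ∉ p.natWrites) {B : ℕ} (n : ℕ)
    (hp : ∀ s : Memory, s.nat 0 0 0 = n → ∃ t ≤ B, Exec O p.compile s (p.run O s) t)
    (s : Memory) (hs : s.nat 0 0 0 = n) (k i : ℕ) (hi : i + k = n) :
    ∃ t ≤ (loopTest c).cost + k * ((loopTest c).cost + B + 8),
      Exec O (.while (loopTest c) (.seq p.compile (increment c))) (iterate (p.run O) c i s)
        (iterate (p.run O) c n s) t := by
  have hsize (i : ℕ) : (iterate (p.run O) c i s).nat 0 0 0 = n := by
    rw [(agree_iterate c p s i).nat 0 (by simp [natWrites, h0, hc.symm]), hs]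
  induction k generalizing i with
  | zero =>
    obtain rfl : i = n := by omega
    refine ⟨_, by simp, .whileFalse ?_⟩
    simp [loopTest, Test.Holds, NatExpr.eval, hsize, iterate_counter]
  | succ k ih =>
    obtain ⟨t, ht, he⟩ := hp (iterate (p.run O) c i s) (hsize i)
    obtain ⟨t', ht', he'⟩ := ih (i + 1) (by omega)
    -- The cost 8 is 1 + 1 for the two positions, 5 for the sum and 1 for the assignment.
    have hinc : Exec O (increment c) (p.run O (iterate (p.run O) c i s))
        (iterate (p.run O) c (i + 1) s) 8 := by
      have := Exec.setNat (O := O) (p.run O (iterate (p.run O) c i s)) c (.lit 0) (.lit 0)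
        (.add (.var c) (.lit 1))
      simpa [NatExpr.eval, NatExpr.cost, nat_run p _ c hc', iterate_counter, increment, iterate]
        using this
    refine ⟨_, ?_, .whileTrue ?_ (.seq he hinc) he'⟩
    · rw [Nat.succ_mul]; omega
    · simp [loopTest, Test.Holds, NatExpr.eval, hsize, iterate_counter]; omega

theorem exec_compile (p : LoopProgram) (hp : p.WellFormed = true) (h0 : 0 ∉ p.natWrites)
    (s : Memory) : ∃ t ≤ p.bound.eval (s.nat 0 0 0), Exec O p.compile s (p.run O s) t := by
  induction p generalizing s with
  | skip => exact ⟨1, by simp [bound], .skip s⟩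
  | setNat a i j e => exact ⟨_, by simp [bound], .setNat s a i j e⟩
  | setReal a i j x => exact ⟨_, by simp [bound], .setReal s a i j x⟩
  | query a b =>
    refine ⟨1, by simp [bound], ?_⟩
    by_cases h : O {i | s.nat b i 0 ≠ 0}
    · simpa [run, compile, h] using Exec.queryYes s a b h
    · simpa [run, compile, h] using Exec.queryNo s a b h
  | seq p q ihp ihq =>
    simp only [WellFormed, Bool.and_eq_true, natWrites, List.mem_append, not_or] at hp h0
    obtain ⟨t, ht, h⟩ := ihp hp.1 h0.1 s
    obtain ⟨t', ht', h'⟩ := ihq hp.2 h0.2 (p.run O s)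
    rw [nat_run p s 0 h0.1] at ht'
    exact ⟨_, by simpa [bound] using Nat.add_le_add ht ht', .seq h h'⟩
  | ite b p q ihp ihq =>
    simp only [WellFormed, Bool.and_eq_true, natWrites, List.mem_append, not_or] at hp h0
    by_cases hb : b.Holds s
    · obtain ⟨t, ht, h⟩ := ihp hp.1 h0.1 s
      refine ⟨b.cost + t, by simp [bound]; omega, ?_⟩
      simpa [run, hb, compile] using Exec.iteTrue (Q := q.compile) hb h
    · obtain ⟨t, ht, h⟩ := ihq hp.2 h0.2 s
      refine ⟨b.cost + t, by simp [bound]; omega, ?_⟩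
      simpa [run, hb, compile] using Exec.iteFalse (P := p.compile) hb h
  | loop c p ih =>
    simp only [WellFormed, Bool.and_eq_true, bne_iff_ne, Bool.not_eq_true',
      List.contains_eq_mem, decide_eq_false_iff_not] at hp
    obtain ⟨⟨⟨hp, hc⟩, hc'⟩, h0⟩ := hp
    obtain ⟨t, ht, h⟩ := exec_while hc hc' h0 (s.nat 0 0 0)
      (fun s' hs' => hs' ▸ ih hp h0 s') s rfl (s.nat 0 0 0) 0 (by omega)
    -- Resetting the counter costs three literals and one assignment, the 4 in `bound`.
    have hz := Exec.setNat (O := O) s c (.lit 0) (.lit 0) (.lit 0)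
    refine ⟨_, ?_, .seq hz h⟩
    simp only [NatExpr.cost, bound, Polynomial.eval_add, Polynomial.eval_mul, Polynomial.eval_X,
      Polynomial.eval_C, Polynomial.eval_ofNat]
    omega

end LoopProgram

/-! ### Independent transversals -/

/-- The values of `φ` on `S` are distinct representatives of the sets `N s`, and they form an
independent set. -/
structure IsTransversal {α : Type*} (M : Matroid α) (N : α → Set α) (S : Finset α) (φ : α → α) :
    Prop where
  injOn : Set.InjOn φ S
  mem : ∀ s ∈ S, φ s ∈ N s
  indep : M.Indep (φ '' S)

/-- `S` has a transversal whose set of values stays independent when `A` is added. -/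
def HasTransversal {α : Type*} (M : Matroid α) (N : α → Set α) (S A : Finset α) : Prop :=
  ∃ φ, IsTransversal M N S φ ∧ Disjoint (φ '' S) A ∧ M.Indep (φ '' S ∪ A)

namespace IsTransversal

variable {α : Type*} {M : Matroid α} {N : α → Set α} {S T : Finset α} {φ ψ : α → α}

theorem hasTransversal (h : IsTransversal M N S φ) : HasTransversal M N S ∅ :=
  ⟨φ, h, by simp, by simpa using h.indep⟩

theorem empty (φ : α → α) : IsTransversal M N ∅ φ := ⟨by simp, by simp, by simp⟩

theorem congr (h : IsTransversal M N S φ) (e : ∀ s ∈ S, ψ s = φ s) : IsTransversal M N S ψ :=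
  ⟨h.injOn.congr fun s hs => (e s hs).symm, fun s hs => e s hs ▸ h.mem s hs,
    Set.image_congr (fun s hs => e s hs) ▸ h.indep⟩

theorem mono (h : IsTransversal M N T φ) (hST : S ⊆ T) : IsTransversal M N S φ :=
  ⟨h.injOn.mono (by simpa using hST), fun s hs => h.mem s (hST hs),
    h.indep.subset (Set.image_mono (by simpa using hST))⟩

theorem notMem_image (h : IsTransversal M N S φ) {x : α} (hx' : x ∉ M.closure (φ '' S)) :
    x ∉ φ '' S := fun hxS => hx' (M.mem_closure_of_mem hxS h.indep.subset_ground)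

theorem indep_insert (h : IsTransversal M N S φ) {x : α} (hx : x ∈ M.E)
    (hx' : x ∉ M.closure (φ '' S)) : M.Indep (insert x (φ '' S)) :=
  (h.indep.notMem_closure_iff_of_notMem (h.notMem_image hx') hx).1 hx'

variable [DecidableEq α]

/-- The old representative of `s` is given up, so `x` only has to be compatible with the other ones.
-/
theorem update_mem (h : IsTransversal M N S φ) {s x : α} (hs : s ∈ S) (hx : x ∈ N s)
    (hx' : x ∉ φ '' (S \ {s})) (hind : M.Indep (insert x (φ '' (S \ {s})))) :
    IsTransversal M N S (Function.update φ s x) := by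
  have hne : ∀ t ∈ S, t ≠ s → φ t ≠ x := fun t ht hts e => hx' ⟨t, ⟨ht, hts⟩, e⟩
  refine ⟨fun t ht t' ht' e => ?_, fun t ht => ?_, hind.subset ?_⟩
  · by_cases h1 : t = s <;> by_cases h2 : t' = s
    · rw [h1, h2]
    · subst h1; simp [Function.update_of_ne h2] at e; exact absurd e.symm (hne t' ht' h2)
    · subst h2; simp [Function.update_of_ne h1] at e; exact absurd e (hne t ht h1)
    · simp only [Function.update_of_ne h1, Function.update_of_ne h2] at e
      exact h.injOn ht ht' e
  · by_cases h1 : t = s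
    · subst h1; simpa
    · simpa [Function.update_of_ne h1] using h.mem t ht
  · rintro _ ⟨t, ht, rfl⟩
    by_cases h1 : t = s
    · subst h1; simp
    · exact .inr ⟨t, ⟨ht, h1⟩, by simp [Function.update_of_ne h1]⟩

theorem update_insert (h : IsTransversal M N S φ) {u x : α} (hu : u ∉ S) (hx : x ∈ N u)
    (hx' : x ∉ φ '' S) (hind : M.Indep (insert x (φ '' S))) :
    IsTransversal M N (insert u S) (Function.update φ u x) := by
  have e : ∀ t ∈ S, Function.update φ u x t = φ t := fun t ht =>
    Function.update_of_ne (fun e => hu (e.subst ht)) ..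
  have e' : Function.update φ u x '' S = φ '' S := Set.image_congr e
  refine ⟨?_, fun t ht => ?_, ?_⟩
  · rw [Finset.coe_insert, Set.injOn_insert (by simpa using hu), e']
    exact ⟨(h.congr e).injOn, by simpa using hx'⟩
  · obtain rfl | ht := Finset.mem_insert.1 ht
    · simpa
    · rw [e t ht]; exact h.mem t ht
  · rw [Finset.coe_insert, Set.image_insert_eq, e']; simpa

/-- A larger transversal can be completed by all but one of the elements that complete a smaller
one. -/
theorem exists_erase {u : α} {O : Finset α} (hφ : IsTransversal M N (insert u S) φ) (hu : u ∉ S)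
    (hO : O.Nonempty) (hS : HasTransversal M N S O) :
    ∃ o ∈ O, HasTransversal M N (insert u S) (O.erase o) := by
  obtain ⟨ψ, hψ, hdisj, hind⟩ := hS
  -- Among all transversals of `insert u S`, take one that differs from `ψ` at as few points of `S`
  -- as possible.
  obtain ⟨φ, hφ : IsTransversal M N _ φ, hmin⟩ :=
    (measure fun χ : α → α => (S.filter fun s => χ s ≠ ψ s).card).wf.has_min
      {χ | IsTransversal M N (insert u S) χ} ⟨φ, hφ⟩
  have hT : (insert u S).card = S.card + 1 := Finset.card_insert_of_notMem hu
  -- The set `A` is enlarged one element of `O` at a time until only one is missing.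
  suffices ∀ k, k + 1 ≤ O.card → ∃ A ⊆ O, A.card = k ∧ Disjoint ((insert u S).image φ) A ∧
      M.Indep ((insert u S).image φ ∪ A : Finset α) by
    obtain ⟨A, hAO, hA, hd, hi⟩ := this (O.card - 1) (by have := hO.card_pos; omega)
    obtain ⟨o, ho, hoA⟩ : ∃ o ∈ O, o ∉ A := Finset.exists_mem_notMem_of_card_lt_card
      (by have := hO.card_pos; omega)
    obtain rfl : A = O.erase o := Finset.eq_of_subset_of_card_le
      (fun a ha => Finset.mem_erase.2 ⟨fun h => hoA (h ▸ ha), hAO ha⟩)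
      (by rw [Finset.card_erase_of_mem ho, hA])
    refine ⟨o, ho, φ, hφ, ?_, by simpa [Set.image_insert_eq, Set.insert_union] using hi⟩
    rw [← Finset.coe_image]; exact_mod_cast hd
  intro k
  induction k with
  | zero => exact fun _ => ⟨∅, by simp, rfl, by simp, by simpa [Set.image_insert_eq] using hφ.indep⟩
  | succ k ih =>
    intro hk
    obtain ⟨A, hAO, rfl, hd, hi⟩ := ih (by omega)
    have hd' : Disjoint (S.image ψ) O := by
      rw [← Finset.coe_image] at hdisj; exact_mod_cast hdisj
    -- As `A` has at least two elements fewer than `O`, the set `φ (S ∪ {u}) ∪ A` is smaller than `ψ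
    -- S ∪ O` and can be augmented from it.
    obtain ⟨x, hx, hxI, hxi⟩ := hi.augment_finset (J := S.image ψ ∪ O) (by simpa using hind) (by
      rw [Finset.card_union_of_disjoint hd, Finset.card_union_of_disjoint hd',
        Finset.card_image_of_injOn hφ.injOn, Finset.card_image_of_injOn hψ.injOn, hT]
      omega)
    simp only [Finset.mem_union, not_or] at hx hxI
    by_cases hxO : x ∈ O
    · refine ⟨insert x A, Finset.insert_subset hxO hAO, Finset.card_insert_of_notMem hxI.2, ?_, ?_⟩
      · rw [Finset.disjoint_insert_right]; exact ⟨hxI.1, hd⟩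
      · rwa [Finset.union_insert, Finset.coe_insert]
    -- An augmenting element `ψ s` outside `O` could replace `φ s`, giving a transversal that agrees
    -- with `ψ` at one more point.
    · obtain ⟨s, hs, rfl⟩ := Finset.mem_image.1 (hx.resolve_right hxO)
      have hxφ : ψ s ∉ φ '' (insert u S : Finset α) := by
        rw [← Finset.coe_image]; exact_mod_cast hxI.1
      refine absurd ?_ (hmin _ (hφ.update_mem (Finset.mem_insert_of_mem hs) (hψ.mem s hs)
        (fun h => hxφ (Set.image_mono Set.sdiff_subset h)) (hxi.subset ?_)))
      · refine Finset.card_lt_card (Finset.ssubset_iff_of_subset (fun t ht => ?_) |>.2 ⟨s, ?_⟩)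
        · simp only [Finset.mem_filter] at ht ⊢
          refine ⟨ht.1, fun e => ht.2 ?_⟩
          by_cases h1 : t = s
          · subst h1; simp
          · simpa [Function.update_of_ne h1] using e
        · simp only [Finset.mem_filter, Function.update_self, hs, true_and, ne_eq, not_true,
            not_false_eq_true, and_true]
          exact fun e => hxφ ⟨s, by simp [hs], e⟩
      · refine Set.insert_subset_insert ?_
        rw [Finset.coe_union, Finset.coe_image]
        exact (Set.image_mono Set.sdiff_subset).trans Set.subset_union_left

/-- A set of nodes that is closed in the exchange graph and has no exit certifies that there is no
larger transversal. -/
theorem not_of_closed {u : α} (hφ : IsTransversal M N S φ) (hu : u ∉ S) {J : Finset α}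
    (hJ : J ⊆ insert u S) (huJ : u ∈ J) (hsink : ∀ s ∈ J, N s ⊆ M.closure (φ '' S))
    (hclosed : ∀ s ∈ J, ∀ x ∈ N s, ∀ t ∈ S, x ∉ M.closure (φ '' (S \ {t})) → t ∈ J) :
    ¬ IsTransversal M N (insert u S) ψ := by
  intro hψ
  have hsub : ψ '' J ⊆ M.closure (φ '' (J.erase u)) := by
    rintro _ ⟨s, hs, rfl⟩
    have hψs := hψ.mem s (hJ hs)
    -- Within the independent set `φ '' S`, closure commutes with intersection. By closedness `ψ s`
    -- is spanned without `φ t` for every `t ∈ S \ J`, hence by the representatives of `J` alone,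
    -- and `u` has none.
    have key := hφ.indep.closure_sInter_eq_biInter_closure_of_forall_subset
      (Js := insert (φ '' S) ((fun t => φ '' (S \ {t})) '' (S \ J))) ⟨_, Set.mem_insert _ _⟩ (by
        rintro _ (rfl | ⟨t, -, rfl⟩)
        · rfl
        · exact Set.image_mono Set.sdiff_subset)
    have hmem : ψ s ∈ M.closure (⋂₀ insert (φ '' S) ((fun t => φ '' (S \ {t})) '' (S \ J))) := by
      rw [key]
      simp only [Set.mem_iInter, Set.mem_insert_iff]
      rintro _ (rfl | ⟨t, ht, rfl⟩)
      · exact hsink s hs hψs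
      · exact by_contra fun h => ht.2 (hclosed s hs _ hψs t ht.1 h)
    refine M.closure_subset_closure ?_ hmem
    intro y hy
    simp only [Set.mem_sInter, Set.mem_insert_iff] at hy
    obtain ⟨t, ht, rfl⟩ := hy _ (.inl rfl)
    refine ⟨t, ?_, rfl⟩
    by_cases htJ : t ∈ J
    · simp only [Finset.coe_erase, Set.mem_sdiff, Set.mem_singleton_iff]
      exact ⟨htJ, fun e => hu (e ▸ ht)⟩
    · obtain ⟨t', ht', e⟩ := hy _ (.inr ⟨t, ⟨ht, htJ⟩, rfl⟩)
      exact absurd (hφ.injOn ht'.1 ht e) ht'.2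
  have hJi := hψ.mono hJ
  -- An independent set of `|J|` elements would lie in the span of at most `|J| - 1` elements.
  have h1 : (ψ '' J).encard ≤ (φ '' (J.erase u)).encard := by
    refine (hJi.indep.encard_le_eRk_of_subset hsub).trans ?_
    rw [M.eRk_closure_eq]
    exact M.eRk_le_encard _
  rw [hJi.injOn.encard_image] at h1
  have h2 := h1.trans (Set.encard_image_le _ _)
  rw [Set.encard_coe_eq_coe_finsetCard, Set.encard_coe_eq_coe_finsetCard, Nat.cast_le,
    Finset.card_erase_of_mem huJ] at h2
  have := Finset.card_pos.2 ⟨u, huJ⟩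
  omega

/-- What is still spanned after one representative has been moved to an element independent of all
of them was spanned without this representative. -/
theorem mem_closure_of_mem_closure_update (h : IsTransversal M N S φ) {s x y : α}
    (hx : x ∈ M.E) (hx' : x ∉ M.closure (φ '' S)) (hy : y ∈ M.closure (φ '' S))
    {R : Set α} (hR : R ⊆ S) (hyR : y ∈ M.closure (Function.update φ s x '' R)) :
    y ∈ M.closure (φ '' (R \ {s})) := by
  have himg : Function.update φ s x '' R ⊆ insert x (φ '' (R \ {s})) := by
    rintro _ ⟨r, hr, rfl⟩
    by_cases hrs : r = s
    · subst hrs; simp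
    · exact .inr ⟨r, ⟨hr, hrs⟩, by simp [Function.update_of_ne hrs]⟩
  -- Both sets lie in one independent set, so an element spanned by each of them is spanned by their
  -- intersection, which does not contain `x`.
  have h2 : M.Indep (insert x (φ '' (R \ {s})) ∪ φ '' S) := by
    refine (h.indep_insert hx hx').subset
      (Set.union_subset (Set.insert_subset_insert ?_) (Set.subset_insert _ _))
    exact Set.image_mono (Set.sdiff_subset.trans hR)
  have h3 : y ∈ M.closure (insert x (φ '' (R \ {s})) ∩ φ '' S) := by
    rw [h2.closure_inter_eq_inter_closure]
    exact ⟨M.closure_subset_closure himg hyR, hy⟩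
  refine M.closure_subset_closure ?_ h3
  rintro z ⟨rfl | hz, hz'⟩
  · exact absurd hz' (h.notMem_image hx')
  · exact hz

end IsTransversal

/-! ### Moving exits along a search of the exchange graph. -/

/-- `L 0 = u, L 1, …, L k` are nodes of the exchange graph, each of them reached from an earlier
one. -/
structure IsSearch {α : Type*} (M : Matroid α) (N : α → Set α) (S : Finset α) (φ : α → α) (u : α)
    (L : ℕ → α) (k : ℕ) : Prop where
  zero : L 0 = u
  mem : ∀ i ≤ k, 0 < i → L i ∈ S
  reach : ∀ i ≤ k, 0 < i → ∃ j < i, ∃ x ∈ N (L j), x ∉ M.closure (φ '' (S \ {L i}))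

/-- The node `s` may move to an element that is independent of all representatives. -/
def IsExit {α : Type*} (M : Matroid α) (N : α → Set α) (S : Finset α) (φ : α → α) (s : α) : Prop :=
  ∃ x ∈ N s, x ∉ M.closure (φ '' S)

/-- After the first exit of a search has moved, an earlier node is an exit. -/
theorem IsSearch.exists_exit_update {α : Type*} [DecidableEq α] {M : Matroid α} {N : α → Set α}
    {S : Finset α} {φ : α → α} {u : α} {L : ℕ → α} {k : ℕ} (h : IsSearch M N S φ u L k)
    (hφ : IsTransversal M N S φ) (hN : ∀ s, N s ⊆ M.E) (hk : 0 < k)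
    (hfirst : ∀ j < k, ¬ IsExit M N S φ (L j)) {x : α} (hx : x ∈ N (L k))
    (hx' : x ∉ M.closure (φ '' S)) :
    IsTransversal M N S (Function.update φ (L k) x) ∧
      ∃ j < k, IsSearch M N S (Function.update φ (L k) x) u L j ∧
        IsExit M N S (Function.update φ (L k) x) (L j) := by
  classical
  have hspan : ∀ j < k, ∀ y ∈ N (L j), y ∈ M.closure (φ '' S) := fun j hj y hy =>
    by_contra fun hy' => hfirst j hj ⟨y, hy, hy'⟩
  have hsub : φ '' ((S : Set α) \ {L k}) ⊆ φ '' S := Set.image_mono Set.sdiff_subset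
  refine ⟨hφ.update_mem (h.mem k le_rfl hk) hx (fun hxs => hφ.notMem_image hx' (hsub hxs))
    ((hφ.indep_insert (hN _ hx) hx').subset (Set.insert_subset_insert hsub)), ?_⟩
  -- Take the node from which `L k` was reached, through `y`. If `y` were still spanned after the
  -- move, it would be spanned without `φ (L k)`, against the arc.
  have hex : ∃ j, j < k ∧ IsExit M N S (Function.update φ (L k) x) (L j) := by
    obtain ⟨j, hj, y, hy, hy'⟩ := h.reach k le_rfl hk
    exact ⟨j, hj, y, hy, fun hyS => hy' (hφ.mem_closure_of_mem_closure_update (hN _ hx) hx'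
      (hspan j hj y hy) subset_rfl hyS)⟩
  obtain ⟨j, hj, hj'⟩ := hex
  -- Arcs between earlier nodes survive for the same reason: they leave nodes that were not exits,
  -- so their elements were spanned by `φ '' S`.
  refine ⟨j, hj, ⟨h.zero, fun i hi => h.mem i (by omega), fun i hi hi0 => ?_⟩, hj'⟩
  obtain ⟨l, hl, y, hy, hyi⟩ := h.reach i (by omega) hi0
  refine ⟨l, hl, y, hy, fun hyS => hyi ?_⟩
  exact M.closure_subset_closure (Set.image_mono Set.sdiff_subset)
    (hφ.mem_closure_of_mem_closure_update (hN _ hx) hx' (hspan l (by omega) y hy)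
      Set.sdiff_subset hyS)

/-! ### The greedy selection -/

section Greedy

open scoped Classical in
/-- The points of `V` at distance at most `r` from some point of `C`. -/
noncomputable def coverIn {α : Type*} (V : Finset α) (D : α → α → ℝ) (C : Finset α) (r : ℝ) :
    Finset α :=
  V.filter fun v => ∃ u ∈ C, D u v ≤ r

/-- The points of `V` at distance at most `r + r` from `s`. -/
def vicinity {α : Type*} (V : Finset α) (D : α → α → ℝ) (r : ℝ) (s : α) : Set α :=
  {x | x ∈ V ∧ D s x ≤ r + r}

variable {α : Type*} {V S Cov O : Finset α} {D : α → α → ℝ} {W : α → ℝ}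
  {M : Matroid α} {r m : ℝ}

theorem mem_coverIn {C : Finset α} {v : α} :
    v ∈ coverIn V D C r ↔ v ∈ V ∧ ∃ u ∈ C, D u v ≤ r := by
  classical simp [coverIn]

theorem HasTransversal.mono_right {N : α → Set α} {A B : Finset α} (h : HasTransversal M N S B)
    (hAB : A ⊆ B) : HasTransversal M N S A := by
  obtain ⟨φ, hφ, hd, hi⟩ := h
  exact ⟨φ, hφ, hd.mono_right (by simpa using hAB),
    hi.subset (Set.union_subset_union_right _ (by simpa using hAB))⟩

variable [DecidableEq α]

/-- The selection `S`, whose clusters are `Cov`, can be completed: part of an optimal solution is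
still compatible with it, and covers enough of what is missing. -/
def Promising (V : Finset α) (D : α → α → ℝ) (W : α → ℝ) (M : Matroid α) (r m : ℝ)
    (S Cov : Finset α) : Prop :=
  ∃ O ⊆ V, HasTransversal M (vicinity V D r) S O ∧ (∀ o ∈ O, ∀ s ∈ S, r + r < D s o) ∧
    m ≤ ∑ v ∈ Cov ∪ coverIn V D O r, W v

theorem promising_empty {C : Finset α} (hC : C ⊆ V) (hi : M.Indep C)
    (hm : m ≤ ∑ v ∈ coverIn V D C r, W v) : Promising V D W M r m ∅ ∅ :=
  ⟨C, hC, ⟨id, .empty id, by simp, by simpa using hi⟩, by simp, by simpa using hm⟩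

/-- The element `o` changes sides and becomes the representative of `u`; the independent union stays
the same. -/
theorem HasTransversal.insert_erase {N : α → Set α} {u o : α} (h : HasTransversal M N S O)
    (hu : u ∉ S) (ho : o ∈ O) (huo : o ∈ N u) : HasTransversal M N (insert u S) (O.erase o) := by
  obtain ⟨φ, hφ, hd, hi⟩ := h
  have hoφ : o ∉ φ '' S := fun h => Set.disjoint_left.1 hd h ho
  have e : Function.update φ u o '' (insert u S : Finset α) = insert o (φ '' S) := by
    rw [Finset.coe_insert, Set.image_insert_eq, Function.update_self]
    congr 1
    exact Set.image_congr fun t ht => Function.update_of_ne (fun e => hu (e.subst ht)) ..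
  refine ⟨_, hφ.update_insert hu huo hoφ (hi.subset ?_), ?_, hi.subset ?_⟩
  · exact Set.insert_subset (.inr ho) Set.subset_union_left
  · rw [e, Set.disjoint_insert_left]
    exact ⟨by simp, hd.mono_right (by simp)⟩
  · rw [e]
    refine Set.union_subset (Set.insert_subset (.inr ho) Set.subset_union_left) ?_
    exact Set.subset_union_of_subset_right (by simp) _

/-- A selection that cannot be extended already covers enough. -/
theorem Promising.le_of_maximal (h : Promising V D W M r m S Cov) (hr : 0 ≤ r)
    (hD0 : ∀ x ∈ V, D x x = 0)
    (hmax : ∀ u ∈ V, u ∉ S → ¬ HasTransversal M (vicinity V D r) (insert u S) ∅) :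
    m ≤ ∑ v ∈ Cov, W v := by
  obtain ⟨O, hOV, hT, hfar, hm⟩ := h
  -- A point of `O` is not in `S`, being far from it, and could be added with itself as
  -- representative.
  obtain rfl : O = ∅ := by
    refine Finset.eq_empty_of_forall_notMem fun o ho => ?_
    have hoS : o ∉ S := fun hoS => by
      have := hfar o ho o hoS
      rw [hD0 o (hOV ho)] at this
      linarith
    refine hmax o (hOV ho) hoS ((hT.insert_erase hoS ho ⟨hOV ho, ?_⟩).mono_right (by simp))
    rw [hD0 o (hOV ho)]
    linarith
  have : coverIn V D ∅ r = ∅ := by ext; simp [mem_coverIn]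
  simpa [this] using hm

/-- The greedy choice keeps a selection promising. -/
theorem Promising.insert (h : Promising V D W M r m S Cov) (hr : 0 ≤ r)
    (hW : ∀ v ∈ V, 0 ≤ W v) (hD0 : ∀ x ∈ V, D x x = 0)
    (hDs : ∀ x ∈ V, ∀ y ∈ V, D x y = D y x)
    (hDt : ∀ x ∈ V, ∀ y ∈ V, ∀ z ∈ V, D x z ≤ D x y + D y z) {u : α} (huV : u ∈ V) (hu : u ∉ S)
    (hT : HasTransversal M (vicinity V D r) (insert u S) ∅) (hCov : Cov ⊆ V)
    (hmax : ∀ o ∈ V, o ∉ S → HasTransversal M (vicinity V D r) (insert o S) ∅ →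
      ∑ v ∈ coverIn V D {o} r \ Cov, W v ≤ ∑ v ∈ coverIn V D {u} r \ Cov, W v) :
    Promising V D W M r m (insert u S) (Cov ∪ coverIn V D {u} (r + r + r)) := by
  obtain ⟨O, hOV, hO, hfar, hm⟩ := h
  have hcV : ∀ (C : Finset α) r, coverIn V D C r ⊆ V := fun C r v hv => (mem_coverIn.1 hv).1
  by_cases hnear : ∃ o ∈ O, D u o ≤ r + r
  -- The near point `o` represents `u`, and all points of `O` within `2r` of `u` are dropped.
  · obtain ⟨o, ho, huo⟩ := hnear
    refine ⟨O.filter fun o => r + r < D u o, (O.filter_subset _).trans hOV,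
      (hO.insert_erase hu ho ⟨hOV ho, huo⟩).mono_right fun o' ho' => ?_, fun o' ho' s hs => ?_,
      hm.trans (Finset.sum_le_sum_of_subset_of_nonneg ?_ fun v hv _ => hW v ?_)⟩
    · obtain ⟨ho', hd⟩ := Finset.mem_filter.1 ho'
      exact Finset.mem_erase.2 ⟨fun e => by subst e; linarith, ho'⟩
    · obtain ⟨ho', hd⟩ := Finset.mem_filter.1 ho'
      obtain rfl | hs := Finset.mem_insert.1 hs
      · exact hd
      · exact hfar o' ho' s hs
    · intro v hv
      simp only [Finset.mem_union, mem_coverIn, Finset.mem_singleton, exists_eq_left,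
        Finset.mem_filter] at hv ⊢
      obtain hv | ⟨hvV, o', ho', hv⟩ := hv
      · exact .inl (.inl hv)
      · by_cases hd : r + r < D u o'
        · exact .inr ⟨hvV, o', ⟨ho', hd⟩, hv⟩
        -- `v` is within `r` of a dropped point, which is within `2r` of `u`: hence the radius `3r`.
        · exact .inl (.inr ⟨hvV, by linarith [hDt u huV o' (hOV ho') v hvV]⟩)
    · obtain hv | hv := Finset.mem_union.1 hv
      · obtain hv | hv := Finset.mem_union.1 hv
        · exact hCov hv
        · exact hcV _ _ hv
      · exact hcV _ _ hv
  · push Not at hnear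
    have hfar' : ∀ o ∈ O, ∀ s ∈ Insert.insert u S, r + r < D s o := fun o ho s hs => by
      obtain rfl | hs := Finset.mem_insert.1 hs
      · exact hnear o ho
      · exact hfar o ho s hs
    have hcov : ∀ (A B : Finset α), A ⊆ B → B ⊆ V → ∑ v ∈ A, W v ≤ ∑ v ∈ B, W v :=
      fun A B hAB hB => Finset.sum_le_sum_of_subset_of_nonneg hAB fun v hv _ => hW v (hB hv)
    have hbig : Cov ∪ coverIn V D {u} (r + r + r) ⊆ V := Finset.union_subset hCov (hcV _ _)
    -- With `O` empty there is nothing to give up, and the transversal of `insert u S` is enough.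
    obtain rfl | hne := O.eq_empty_or_nonempty
    · refine ⟨∅, by simp, hT, by simp, hm.trans (hcov _ _ ?_ ?_)⟩
      · exact Finset.union_subset_union_left Finset.subset_union_left
      · exact Finset.union_subset hbig (hcV _ _)
    · obtain ⟨φ, hφ, -⟩ := hT
      obtain ⟨o, ho, hO'⟩ := hφ.exists_erase hu hne hO
      refine ⟨O.erase o, (O.erase_subset o).trans hOV, hO',
        fun o' ho' => hfar' o' (Finset.mem_of_mem_erase ho'), hm.trans ?_⟩
      have hoS : o ∉ S := fun hoS => by
        have := hfar o ho o hoS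
        rw [hD0 o (hOV ho)] at this
        linarith
      -- The sacrificed point was itself a candidate, so the greedy rule compares it with `u`.
      have hgain := hmax o (hOV ho) hoS ((hO.insert_erase hoS ho ⟨hOV ho, by
        rw [hD0 o (hOV ho)]; linarith⟩).mono_right (by simp))
      -- A common point would put `u` within `2r` of `O`. Disjointness lets the weight of the ball
      -- around `u` replace that around `o`.
      have hdisj : Disjoint (coverIn V D {u} r \ Cov) (coverIn V D (O.erase o) r \ Cov) := by
        rw [Finset.disjoint_left]
        intro v hv hv'
        simp only [Finset.mem_sdiff, mem_coverIn, Finset.mem_singleton, exists_eq_left] at hv hv'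
        obtain ⟨⟨hvV, hv⟩, -⟩ := hv
        obtain ⟨⟨-, o', ho', hv'⟩, -⟩ := hv'
        have ho' := Finset.mem_of_mem_erase ho'
        have h1 := hDt u huV v hvV o' (hOV ho')
        have h2 := hDs v hvV o' (hOV ho')
        have h3 := hnear o' ho'
        linarith
      calc ∑ v ∈ Cov ∪ coverIn V D O r, W v
          ≤ ∑ v ∈ Cov ∪ (coverIn V D {o} r \ Cov ∪ coverIn V D (O.erase o) r \ Cov), W v := by
            refine hcov _ _ (fun v hv => ?_) ?_
            · simp only [Finset.mem_union, mem_coverIn, Finset.mem_singleton, exists_eq_left,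
                Finset.mem_sdiff, Finset.mem_erase] at hv ⊢
              by_cases hvC : v ∈ Cov
              · exact .inl hvC
              obtain hv | ⟨hvV, o', ho', hv⟩ := hv
              · exact .inl hv
              · by_cases e : o' = o
                · subst e; exact .inr (.inl ⟨⟨hvV, hv⟩, hvC⟩)
                · exact .inr (.inr ⟨⟨hvV, o', ⟨e, ho'⟩, hv⟩, hvC⟩)
            · exact Finset.union_subset hCov (Finset.union_subset
                (Finset.sdiff_subset.trans (hcV _ _)) (Finset.sdiff_subset.trans (hcV _ _)))
        _ ≤ ∑ v ∈ Cov, W v + (∑ v ∈ coverIn V D {o} r \ Cov, W v +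
              ∑ v ∈ coverIn V D (O.erase o) r \ Cov, W v) := by
            have h1 := Finset.sum_union_inter (f := W) (s₁ := coverIn V D {o} r \ Cov)
              (s₂ := coverIn V D (O.erase o) r \ Cov)
            have h2 : 0 ≤ ∑ v ∈ coverIn V D {o} r \ Cov ∩ (coverIn V D (O.erase o) r \ Cov), W v :=
              Finset.sum_nonneg fun v hv => hW v
                (hcV _ _ (Finset.sdiff_subset (Finset.mem_of_mem_inter_left hv)))
            rw [Finset.sum_union (by
              rw [Finset.disjoint_union_right]
              exact ⟨Finset.disjoint_sdiff, Finset.disjoint_sdiff⟩)]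
            linarith
        _ ≤ ∑ v ∈ Cov, W v + (∑ v ∈ coverIn V D {u} r \ Cov, W v +
              ∑ v ∈ coverIn V D (O.erase o) r \ Cov, W v) := by linarith
        _ = ∑ v ∈ Cov ∪ (coverIn V D {u} r \ Cov ∪ coverIn V D (O.erase o) r \ Cov), W v := by
            rw [Finset.sum_union (by
              rw [Finset.disjoint_union_right]
              exact ⟨Finset.disjoint_sdiff, Finset.disjoint_sdiff⟩), Finset.sum_union hdisj]
        _ ≤ _ := by
            refine hcov _ _ (fun v hv => ?_) (Finset.union_subset hbig (hcV _ _))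
            simp only [Finset.mem_union, mem_coverIn, Finset.mem_singleton, exists_eq_left,
              Finset.mem_sdiff] at hv ⊢
            obtain hv | ⟨⟨hvV, hv⟩, -⟩ | ⟨hv, -⟩ := hv
            · exact .inl (.inl hv)
            · exact .inl (.inr ⟨hvV, by linarith⟩)
            · exact .inr hv

/-- The representatives of a selection cover its clusters. -/
theorem coverIn_subset_image (hSV : S ⊆ V)
    (hDs : ∀ x ∈ V, ∀ y ∈ V, D x y = D y x)
    (hDt : ∀ x ∈ V, ∀ y ∈ V, ∀ z ∈ V, D x z ≤ D x y + D y z) {φ : α → α}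
    (hφ : IsTransversal M (vicinity V D r) S φ) :
    coverIn V D S (r + r + r) ⊆ coverIn V D (S.image φ) (r + r + r + r + r) := by
  intro v hv
  obtain ⟨hvV, s, hs, hsv⟩ := mem_coverIn.1 hv
  obtain ⟨hφV, hd⟩ := hφ.mem s hs
  refine mem_coverIn.2 ⟨hvV, φ s, Finset.mem_image_of_mem _ hs, ?_⟩
  -- At most `2r` from `φ s` to `s` and `3r` from `s` to `v`.
  have h1 := hDt _ hφV s (hSV hs) v hvV
  have h2 := hDs _ hφV s (hSV hs)
  linarith

end Greedy

/-! ### The algorithm -/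

namespace LoopProgram

/-- The flags marking the selected points. -/
abbrev chosen : ℕ := 3

/-- The representatives of the selected points. -/
abbrev rep : ℕ := 4

/-- The flags marking the covered points. -/
abbrev covered : ℕ := 5

/-- The flags handed to the oracle. -/
abbrev asked : ℕ := 6

/-- The point left out in a test for independence. -/
abbrev omitted : ℕ := 7

/-- The element added in a test for independence. -/
abbrev added : ℕ := 8

/-- The answer of a test for independence. -/
abbrev answer : ℕ := 9

/-- The point at which a search starts. -/
abbrev start : ℕ := 10

/-- The points in the order in which a search reaches them. -/
abbrev order : ℕ := 11

/-- The number of points that a search has reached. -/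
abbrev reached : ℕ := 12

/-- The flags marking the points that a search has reached. -/
abbrev seen : ℕ := 13

/-- The flag telling that an exit has been found. -/
abbrev found : ℕ := 14

/-- The first exit. -/
abbrev exitNode : ℕ := 15

/-- The element to which the first exit may move. -/
abbrev exitElem : ℕ := 16

/-- The flag telling that an augmentation is complete. -/
abbrev finished : ℕ := 17

/-- The flag telling that there is a candidate. -/
abbrev hasBest : ℕ := 18

/-- The best candidate. -/
abbrev best : ℕ := 19

/-- The radius in real array `4`. -/
abbrev radius : ℕ := 4

/-- The gain of a candidate in real array `5`. -/
abbrev gain : ℕ := 5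

/-- The gain of the best candidate in real array `6`. -/
abbrev bestGain : ℕ := 6

/-- The total covered weight in real array `7`. -/
abbrev total : ℕ := 7

/-- The test whether a number is not zero. -/
def nonzero (e : NatExpr) : Test := .not (.leNat e (.lit 0))

/-- The test whether two numbers are equal. -/
def eqNat (e f : NatExpr) : Test := .and (.leNat e f) (.leNat f e)

/-- The test whether a number is less than another one. -/
def ltNat (e f : NatExpr) : Test := .not (.leNat f e)

theorem holds_nonzero {s : Memory} {e : NatExpr} : (nonzero e).Holds s ↔ e.eval s ≠ 0 := by
  simp [nonzero, Test.Holds, NatExpr.eval]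

theorem holds_eqNat {s : Memory} {e f : NatExpr} :
    (eqNat e f).Holds s ↔ e.eval s = f.eval s := le_antisymm_iff.symm

theorem holds_ltNat {s : Memory} {e f : NatExpr} :
    (ltNat e f).Holds s ↔ e.eval s < f.eval s := not_le

/-- The distance of two points. -/
abbrev distance (u v : NatExpr) : RealExpr := .get 0 u v

/-- The value of a real scalar. -/
abbrev realVar (a : ℕ) : RealExpr := .get a (.lit 0) (.lit 0)

/-- Twice the radius. -/
abbrev radius2 : RealExpr := .add (realVar radius) (realVar radius)

/-- Three times the radius. -/
abbrev radius3 : RealExpr := .add radius2 (realVar radius)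

/-- Five times the radius. -/
abbrev radius5 : RealExpr := .add (.add radius3 (realVar radius)) (realVar radius)

/-- Set the first `n` entries of an array to zero. -/
def clear (c a : ℕ) : LoopProgram := loop c (store a (.var c) (.lit 0))

/-- Sum up the weights of the points passing a test. -/
def sumWeights (c a : ℕ) (b : Test) : LoopProgram :=
  assignReal a .zero ;;
  loop c (ite b (assignReal a (.add (realVar a) (.get 1 (.var c) (.lit 0)))) skip)

/-- Decide whether the element `added` is independent of the representatives of the selected points
other than `omitted`. -/
def testIndep : LoopProgram :=
  clear 20 asked ;;
  loop 21 (ite (.and (nonzero (.entry chosen (.var 21)))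
      (.not (eqNat (.var 21) (.var omitted))))
    (store asked (.entry rep (.var 21)) (.lit 1)) skip) ;;
  -- If `added` is already one of the representatives, the oracle would be asked about the same
  -- independent set and say yes; the answer must be no, since the element is spanned.
  ite (nonzero (.entry asked (.var added)))
    (assign answer (.lit 0))
    (store asked (.var added) (.lit 1) ;; query answer asked)

/-- Append the point in counter `25` to the list of points reached, if the element in counter `24`
can replace its representative. -/
def visit : LoopProgram :=
  ite (.and (nonzero (.entry chosen (.var 25))) (.not (nonzero (.entry seen (.var 25)))))
    (assign omitted (.var 25) ;;
      assign added (.var 24) ;;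
      testIndep ;;
      ite (nonzero (.var answer))
        (store seen (.var 25) (.lit 1) ;;
          store order (.var reached) (.var 25) ;;
          assign reached (.add (.var reached) (.lit 1)))
        skip)
    skip

/-- Append the points whose representatives the element in counter `24` can replace, if it is close
to the point at position counter `23` of the list. -/
def visitAll : LoopProgram :=
  ite (.leReal (distance (.entry order (.var 23)) (.var 24)) radius2) (loop 25 visit) skip

/-- Search the exchange graph from `start`. -/
def search : LoopProgram :=
  clear 22 seen ;;
  -- `start` needs no flag in `seen`: it is not chosen, so `visit` never appends it.
  store order (.lit 0) (.var start) ;;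
  assign reached (.lit 1) ;;
  loop 23 (ite (ltNat (.var 23) (.var reached))
    (loop 24 visitAll)
    skip)

/-- Record the point at position counter `26` of the list as the first exit, if it may move to the
element in counter `27` and no exit has been found. -/
def checkExit : LoopProgram :=
  ite (.and (.not (nonzero (.var found)))
      (.leReal (distance (.entry order (.var 26)) (.var 27)) radius2))
    -- The size `n` is not the index of a point, so no representative is left out.
    (assign omitted (.var 0) ;;
      assign added (.var 27) ;;
      testIndep ;;
      ite (nonzero (.var answer))
        (assign found (.lit 1) ;;
          assign exitNode (.entry order (.var 26)) ;;
          assign exitElem (.var 27))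
        skip)
    skip

/-- Find the first exit among the points reached by the search. -/
def findExit : LoopProgram :=
  assign found (.lit 0) ;;
  -- Positions are the outer loop, so the exit recorded has the least position.
  loop 26 (ite (ltNat (.var 26) (.var reached)) (loop 27 checkExit) skip)

/-- Move exits until `start` has a representative, and select it. -/
def augment : LoopProgram :=
  assign finished (.lit 0) ;;
  -- The list of a single search serves all rounds. Each move puts the first exit at an earlier
  -- position, so `n` rounds suffice.
  loop 28 (ite (nonzero (.var finished)) skip
    (findExit ;;
      store rep (.var exitNode) (.var exitElem) ;;
      ite (eqNat (.var exitNode) (.var start))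
        (assign finished (.lit 1)) skip)) ;;
  store chosen (.var start) (.lit 1)

/-- Find the candidate with the largest gain. -/
def selectBest : LoopProgram :=
  assign hasBest (.lit 0) ;;
  loop 30 (ite (nonzero (.entry chosen (.var 30))) skip
    (assign start (.var 30) ;;
      search ;;
      findExit ;;
      ite (nonzero (.var found))
        (sumWeights 29 gain (.and (.not (nonzero (.entry covered (.var 29))))
            (.leReal (distance (.var start) (.var 29)) (realVar radius))) ;;
          ite (.and (nonzero (.var hasBest)) (.leReal (realVar gain) (realVar bestGain))) skip
            (assign hasBest (.lit 1) ;;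
              assign best (.var start) ;;
              assignReal bestGain (realVar gain)))
        skip))

/-- Mark the points close to `start` as covered. -/
def coverStart : LoopProgram :=
  loop 31 (ite (.leReal (distance (.var start) (.var 31)) radius3)
    (store covered (.var 31) (.lit 1)) skip)

/-- Add the best candidate to the selection. -/
def extend : LoopProgram :=
  selectBest ;;
  ite (nonzero (.var hasBest))
    (assign start (.var best) ;;
      -- The list has to be rebuilt, as `selectBest` overwrites it for each point it tests.
      search ;;
      augment ;;
      coverStart)
    skip

/-- The greedy selection for a given radius. -/
def greedy : LoopProgram :=
  clear 32 chosen ;;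
  clear 33 covered ;;
  loop 34 extend

/-- Return the current selection. -/
def record : LoopProgram :=
  assign 1 (.lit 1) ;;
  assignReal 3 radius5 ;;
  clear 36 2 ;;
  loop 37 (ite (nonzero (.entry chosen (.var 37)))
    (store 2 (.entry rep (.var 37)) (.lit 1)) skip)

/-- Run the greedy selection, and keep its result if it is the best solution so far. -/
def attempt : LoopProgram :=
  greedy ;;
  sumWeights 35 total (nonzero (.entry covered (.var 35))) ;;
  -- Real scalar `2` is the bound `m`. A result replaces the recorded one only if its radius is
  -- strictly smaller.
  ite (.and (.leReal (realVar 2) (realVar total))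
      (.not (.and (nonzero (.var 1)) (.leReal (realVar 3) radius5))))
    record skip

/-- The algorithm: try the radius zero and all distances. -/
def main : LoopProgram :=
  -- The radius is still zero here. Without this run nothing would be tried on the empty space.
  attempt ;;
  loop 38 (loop 39 (assignReal radius (distance (.var 38) (.var 39)) ;; attempt))

theorem wellFormed_main : main.WellFormed = true := by decide

theorem zero_notMem_natWrites_main : 0 ∉ main.natWrites := by decide

end LoopProgram

/-! ### Correctness of the algorithm -/

/-- The memory holds an instance: the size, the distances, the weights and the bound. -/
structure HoldsInstance (s : Memory) (n : ℕ) (D : ℕ → ℕ → ℝ) (W : ℕ → ℝ) (m : ℝ) : Prop where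
  size : s.nat 0 0 0 = n
  dist : s.real 0 = D
  weight : ∀ i, s.real 1 i 0 = W i
  bound : s.real 2 0 0 = m

/-- An instance on the points `0, …, n - 1`. -/
structure IsInstance (O : Set ℕ → Prop) (n : ℕ) (M : Matroid ℕ) (D : ℕ → ℕ → ℝ) (W : ℕ → ℝ) :
    Prop where
  -- Flags at indices from `n` on denote no point, so they cannot influence the answer.
  oracle : ∀ A, O A ↔ M.Indep (A ∩ Set.Iio n)
  ground : M.E = Set.Iio n
  weight_nonneg : ∀ v ∈ Finset.range n, 0 ≤ W v
  dist_self : ∀ x ∈ Finset.range n, D x x = 0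
  dist_comm : ∀ x ∈ Finset.range n, ∀ y ∈ Finset.range n, D x y = D y x
  triangle : ∀ x ∈ Finset.range n, ∀ y ∈ Finset.range n, ∀ z ∈ Finset.range n,
    D x z ≤ D x y + D y z

namespace LoopProgram

-- Memory invariants and elementary subroutines.

attribute [local simp] run Test.Holds NatExpr.eval RealExpr.eval holds_nonzero holds_eqNat
  holds_ltNat

/-- The memory holds an instance, the current radius `r`, and a selection `S` with
representatives `φ`. -/
structure HoldsSelection (s : Memory) (n : ℕ) (D : ℕ → ℕ → ℝ) (W : ℕ → ℝ) (m r : ℝ) (S : Finset ℕ)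
    (φ : ℕ → ℕ) : Prop extends HoldsInstance s n D W m where
  radius : s.real radius 0 0 = r
  subset : S ⊆ Finset.range n
  chosen : ∀ i < n, s.nat chosen i 0 ≠ 0 ↔ i ∈ S
  rep : ∀ t ∈ S, s.nat rep t 0 = φ t

theorem _root_.HoldsInstance.agree {s s' : Memory} {n : ℕ} {D : ℕ → ℕ → ℝ} {W : ℕ → ℝ} {m : ℝ}
    (h : HoldsInstance s n D W m) {p : LoopProgram} (hp : p.Agree s s') (h0 : 0 ∉ p.natWrites)
    (h1 : ∀ a ∈ [0, 1, 2], a ∉ p.realWrites) : HoldsInstance s' n D W m :=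
  ⟨by rw [hp.nat _ h0]; exact h.size, by rw [hp.real _ (h1 0 (by decide))]; exact h.dist,
    by rw [hp.real _ (h1 1 (by decide))]; exact h.weight,
    by rw [hp.real _ (h1 2 (by decide))]; exact h.bound⟩

theorem HoldsSelection.agree {s s' : Memory} {n : ℕ} {D : ℕ → ℕ → ℝ} {W : ℕ → ℝ} {m r : ℝ}
    {S : Finset ℕ} {φ : ℕ → ℕ} (h : HoldsSelection s n D W m r S φ) {p : LoopProgram}
    (hp : p.Agree s s') (h0 : ∀ a ∈ [0, 3, 4], a ∉ p.natWrites)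
    (h1 : ∀ a ∈ [0, 1, 2, 4], a ∉ p.realWrites) : HoldsSelection s' n D W m r S φ :=
  { h.toHoldsInstance.agree hp (h0 0 (by decide)) (fun a ha => h1 a (by
      simp only [List.mem_cons] at ha ⊢; tauto)) with
    radius := by rw [hp.real _ (h1 4 (by decide))]; exact h.radius
    subset := h.subset
    chosen := by rw [hp.nat _ (h0 3 (by decide))]; exact h.chosen
    rep := by rw [hp.nat _ (h0 4 (by decide))]; exact h.rep }

theorem HoldsSelection.setNat {s : Memory} {n : ℕ} {D : ℕ → ℕ → ℝ} {W : ℕ → ℝ} {m r : ℝ}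
    {S : Finset ℕ} {φ : ℕ → ℕ} (h : HoldsSelection s n D W m r S φ) {a : ℕ}
    (ha : ∀ b ∈ [0, 3, 4], b ≠ a) (i j v : ℕ) : HoldsSelection (s.setNat a i j v) n D W m r S φ :=
  h.agree (agree_run (O := fun _ => True) (.setNat a (.lit i) (.lit j) (.lit v)) s)
    (fun b hb => by simpa [natWrites] using ha b hb) (by simp [realWrites])

variable {O : Set ℕ → Prop} {n : ℕ} {M : Matroid ℕ} {D : ℕ → ℕ → ℝ} {W : ℕ → ℝ} {m r : ℝ}
  {s : Memory} {S : Finset ℕ} {φ : ℕ → ℕ}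

theorem run_clear {c a : ℕ} (hca : c ≠ a) (hn : s.nat 0 0 0 = n) :
    ∀ i < n, ((clear c a).run O s).nat a i 0 = 0 := by
  refine run_loop (fun k s => ∀ i < k, s.nat a i 0 = 0) hn (by simp) ?_
  intro k s' hk hc _ ih i hi
  simp only [run, NatExpr.eval, Memory.nat_setNat, hc, hca.symm]
  by_cases h : i = k
  · simp [h]
  · simpa [h] using ih i (by omega)

theorem run_sumWeights {c a : ℕ} (ha : a ≠ 1) {b : Test} {A : Finset ℕ}
    (hn : s.nat 0 0 0 = n) (hW : ∀ i, s.real 1 i 0 = W i) (hA : A ⊆ Finset.range n)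
    (hb : ∀ i s', i < n → s'.nat c 0 0 = i → (sumWeights c a b).Agree s s' →
      (b.Holds s' ↔ i ∈ A)) :
    ((sumWeights c a b).run O s).real a 0 0 = ∑ v ∈ A, W v := by
  have key : ((sumWeights c a b).run O s).real a 0 0 =
      ∑ v ∈ Finset.range n, if v ∈ A then W v else 0 := by
    refine run_loop (fun k s' => s'.real a 0 0 = ∑ v ∈ Finset.range k, if v ∈ A then W v else 0)
      (by simpa using hn) (by simp [Memory.real_setReal]) ?_
    intro k s' hk hc hag ih
    have hag' : (sumWeights c a b).Agree s s' := by
      refine ⟨fun x hx => ?_, fun x hx => ?_⟩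
      · rw [hag.nat x (by simpa [sumWeights, natWrites] using hx)]; simp
      · have hx' : x ≠ a := by simp [sumWeights, realWrites] at hx; tauto
        rw [hag.real x (by simpa [sumWeights, realWrites] using hx)]
        simp [s.real_setReal_of_ne hx']
    have hb' := hb k s' hk hc hag'
    have hW' : s'.real 1 k 0 = W k := by
      rw [hag'.real 1 (by simp [sumWeights, realWrites, ha.symm]), hW]
    rw [Finset.sum_range_succ, ← ih]
    by_cases hkA : k ∈ A
    · simp [hb'.2 hkA, Memory.real_setReal, hc, hkA, hW']
    · simp [mt hb'.1 hkA, hkA]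
  rw [key, Finset.sum_ite_mem, Finset.inter_eq_right.2 hA]

theorem run_testIndep (hI : IsInstance O n M D W) (hS : HoldsSelection s n D W m r S φ)
    (hφ : M.Indep (φ '' S)) {t x : ℕ}
    (ht : s.nat omitted 0 0 = t) (hx : s.nat added 0 0 = x) (hxn : x < n) :
    (testIndep.run O s).nat answer 0 0 ≠ 0 ↔ x ∉ M.closure (φ '' (S \ {t})) := by
  have hn := hS.size
  have hE := hI.ground
  set s₁ := (clear 20 asked).run O s with hs₁
  have h₁ : ∀ i < n, s₁.nat asked i 0 = 0 := run_clear (by decide) hn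
  have e₁ : ∀ a, a ∉ (clear 20 asked).natWrites → s₁.nat a = s.nat a := fun a ha => nat_run _ _ _ ha
  let p := loop 21 (ite (.and (nonzero (.entry chosen (.var 21)))
      (.not (eqNat (.var 21) (.var omitted))))
    (store asked (.entry rep (.var 21)) (.lit 1)) skip)
  set s₂ := p.run O s₁ with hs₂
  have e₂ : ∀ a, a ∉ (clear 20 asked ;; p).natWrites → s₂.nat a = s.nat a :=
    fun a ha => nat_run (clear 20 asked ;; p) _ _ ha
  have h₂ : ∀ i < n, s₂.nat asked i 0 ≠ 0 ↔ ∃ u ∈ S, u < n ∧ u ≠ t ∧ φ u = i := by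
    refine run_loop (fun k s' => ∀ i < n, s'.nat asked i 0 ≠ 0 ↔ ∃ u ∈ S, u < k ∧ u ≠ t ∧ φ u = i)
      ((congrFun (congrFun (e₁ 0 (by decide)) 0) 0).trans hn) ?_ ?_
    · intro i hi
      simp [Memory.nat_setNat, h₁ i hi]
    · intro k s' hk hc hag ih i hi
      have hch : s'.nat chosen k 0 ≠ 0 ↔ k ∈ S := by
        rw [hag.nat _ (by decide), e₁ _ (by decide)]; exact hS.chosen k hk
      have hom : s'.nat omitted 0 0 = t := by
        rw [hag.nat _ (by decide), e₁ _ (by decide)]; exact ht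
      have hrep : k ∈ S → s'.nat rep k 0 = φ k := by
        rw [hag.nat _ (by decide), e₁ _ (by decide)]; exact hS.rep k
      by_cases hkS : k ∈ S ∧ k ≠ t
      · rw [run_ite_pos (by simp [hc, hom, hkS.2, hch.2 hkS.1])]
        by_cases hik : φ k = i
        · refine iff_of_true ?_ ⟨k, hkS.1, by omega, hkS.2, hik⟩
          simp [Memory.nat_setNat, hc, hrep hkS.1, hik]
        · have : ((store asked (.entry rep (.var 21)) (.lit 1)).run O s').nat asked i 0 =
              s'.nat asked i 0 := by
            simp [Memory.nat_setNat, hc, hrep hkS.1, Ne.symm hik]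
          rw [Memory.nat_setNat_of_ne _ (by decide), this, ih i hi]
          refine exists_congr fun u => and_congr_right fun hu => ⟨fun h => ⟨by omega, h.2⟩,
            fun h => ⟨?_, h.2⟩⟩
          have : u ≠ k := fun e => hik (e ▸ h.2.2)
          omega
      · rw [run_ite_neg (by simpa [hc, hom] using fun h => not_and.1 hkS (hch.1 h))]
        rw [Memory.nat_setNat_of_ne _ (by decide)]
        refine (ih i hi).trans (exists_congr fun u => and_congr_right fun hu =>
          ⟨fun h => ⟨by omega, h.2⟩, fun h => ⟨?_, h.2⟩⟩)
        have : u ≠ k := fun e => hkS (e ▸ ⟨hu, h.2.1⟩)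
        omega
  have h₂' : ∀ i < n, s₂.nat asked i 0 ≠ 0 ↔ i ∈ φ '' (S \ {t}) := by
    intro i hi
    rw [h₂ i hi]
    constructor
    · rintro ⟨u, hu, -, hut, e⟩
      exact ⟨u, ⟨hu, hut⟩, e⟩
    · rintro ⟨u, ⟨hu, hut⟩, e⟩
      exact ⟨u, hu, Finset.mem_range.1 (hS.subset hu), hut, e⟩
  have hadd : s₂.nat added 0 0 = x := by rw [e₂ _ (by decide)]; exact hx
  have hind : M.Indep (φ '' (S \ {t})) := hφ.subset (Set.image_mono Set.sdiff_subset)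
  have hrun : testIndep.run O s = (ite (nonzero (.entry asked (.var added)))
    (assign answer (.lit 0))
    (store asked (.var added) (.lit 1) ;; query answer asked)).run O s₂ := rfl
  rw [hrun]
  -- If `x` is not among the remaining representatives, it is unspanned exactly when adding it keeps
  -- independence, which is what the oracle decides; otherwise it is spanned.
  by_cases hxm : s₂.nat asked x 0 = 0
  · have hx' : x ∉ φ '' (S \ {t}) := fun h => (h₂' x hxn).2 h hxm
    have hset : {i | (s₂.setNat asked x 0 1).nat asked i 0 ≠ 0} ∩ Set.Iio n =
        insert x (φ '' (S \ {t})) := by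
      ext i
      simp only [Set.mem_inter_iff, Set.mem_ofPred_eq, Set.mem_Iio, Set.mem_insert_iff]
      constructor
      · rintro ⟨h, hi⟩
        by_cases hix : i = x
        · exact .inl hix
        · exact .inr ((h₂' i hi).1 (by simpa [Memory.nat_setNat, hix] using h))
      · rintro (rfl | h)
        · exact ⟨by simp [Memory.nat_setNat], hxn⟩
        · have hi : i < n := by have := hind.subset_ground h; rwa [hE] at this
          refine ⟨?_, hi⟩
          by_cases hix : i = x
          · simp [Memory.nat_setNat, hix]
          · simpa [Memory.nat_setNat, hix] using (h₂' i hi).2 h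
    have hq := hI.oracle {i | (s₂.setNat asked x 0 1).nat asked i 0 ≠ 0}
    rw [hset] at hq
    rw [hind.notMem_closure_iff_of_notMem hx' (by rw [hE]; exact hxn), ← hq,
      run_ite_neg (by simp [hadd, hxm])]
    have hst : (store asked (.var added) (.lit 1)).run O s₂ = s₂.setNat asked x 0 1 := by
      simp [hadd]
    rw [run_seq, hst, run_query_ne_zero]
  · have hx' := (h₂' x hxn).1 hxm
    simp [hadd, hxm, Memory.nat_setNat]
    exact M.mem_closure_of_mem hx' hind.subset_ground


/-! ### Correctness of the search. -/

/-- The state of a search: the list `L` of length `k` of the points reached and the flags `F` of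
these points; the triples `(i, x, t)` in `Q` have been processed. -/
structure SearchState (M : Matroid ℕ) (N : ℕ → Set ℕ) (S : Finset ℕ) (φ : ℕ → ℕ) (u : ℕ)
    (L F : ℕ → ℕ) (k : ℕ) (Q : ℕ → ℕ → ℕ → Prop) : Prop where
  pos : 0 < k
  zero : L 0 = u
  mem : ∀ i < k, 0 < i → L i ∈ S
  reach : ∀ i < k, 0 < i → ∃ j < i, ∃ x ∈ N (L j), x ∉ M.closure (φ '' (S \ {L i}))
  inj : ∀ i < k, ∀ j < i, L j ≠ L i
  flag : ∀ t ∈ S, F t ≠ 0 ↔ ∃ i < k, L i = t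
  closed : ∀ i < k, ∀ x ∈ N (L i), ∀ t ∈ S, Q i x t → x ∉ M.closure (φ '' (S \ {t})) →
    ∃ j < k, L j = t

namespace SearchState

variable {N : ℕ → Set ℕ} {u k : ℕ} {L F : ℕ → ℕ} {Q Q' : ℕ → ℕ → ℕ → Prop}

theorem imp (h : SearchState M N S φ u L F k Q)
    (hQ : ∀ i < k, ∀ x ∈ N (L i), ∀ t ∈ S, Q' i x t → Q i x t) :
    SearchState M N S φ u L F k Q' :=
  { h with closed := fun i hi x hx t ht hq => h.closed i hi x hx t ht (hQ i hi x hx t ht hq) }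

/-- No triple of the new position `k` has been processed (`hQ`), so the new node brings no
closedness obligation; the old ones persist because the list only grows. -/
theorem append (h : SearchState M N S φ u L F k Q) {i x t : ℕ} (hi : i < k)
    (hx : x ∈ N (L i)) (ht : t ∈ S) (hxt : x ∉ M.closure (φ '' (S \ {t}))) (hF : F t = 0)
    (hQ : ∀ y v, ¬ Q k y v)
    {L' F' : ℕ → ℕ} (hL' : ∀ j, L' j = if j = k then t else L j)
    (hF' : ∀ j, F' j = if j = t then 1 else F j) :
    SearchState M N S φ u L' F' (k + 1) Q := by
  have hlt : ∀ j < k, L' j = L j := fun j hj => by rw [hL', if_neg hj.ne]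
  have hk : L' k = t := by rw [hL', if_pos rfl]
  have hnew : ∀ j < k, L j ≠ t := fun j hj e => (h.flag t ht).2 ⟨j, hj, e⟩ hF
  have hold : ∀ v, (∃ j < k + 1, L' j = v) ↔ v = t ∨ ∃ j < k, L j = v := by
    intro v
    constructor
    · rintro ⟨j, hj, e⟩
      obtain hj | rfl := Nat.lt_succ_iff_lt_or_eq.1 hj
      · exact .inr ⟨j, hj, by rw [← hlt j hj, e]⟩
      · exact .inl (by rw [← e, hk])
    · rintro (rfl | ⟨j, hj, e⟩)
      · exact ⟨k, by omega, hk⟩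
      · exact ⟨j, by omega, by rw [hlt j hj, e]⟩
  refine ⟨by omega, by rw [hlt 0 h.pos, h.zero], fun j hj hj0 => ?_, fun j hj hj0 => ?_,
    fun j hj l hl => ?_, fun v hv => ?_, fun j hj y hy v hv hq hyv => ?_⟩
  · obtain hj | rfl := Nat.lt_succ_iff_lt_or_eq.1 hj
    · rw [hlt j hj]; exact h.mem j hj hj0
    · rwa [hk]
  · obtain hj | rfl := Nat.lt_succ_iff_lt_or_eq.1 hj
    · obtain ⟨l, hl, y, hy, hy'⟩ := h.reach j hj hj0
      exact ⟨l, hl, y, by rwa [hlt l (by omega)], by rwa [hlt j hj]⟩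
    · exact ⟨i, hi, x, by rwa [hlt i hi], by rwa [hk]⟩
  · obtain hj | rfl := Nat.lt_succ_iff_lt_or_eq.1 hj
    · rw [hlt j hj, hlt l (by omega)]; exact h.inj j hj l hl
    · rw [hk, hlt l hl]; exact hnew l hl
  · rw [hold, hF']
    by_cases hvt : v = t
    · simp [hvt]
    · simpa [hvt] using h.flag v hv
  · rw [hold]
    obtain hj | rfl := Nat.lt_succ_iff_lt_or_eq.1 hj
    · exact .inr (h.closed j hj y (by rwa [hlt j hj] at hy) v hv hq hyv)
    · exact absurd hq (hQ y v)

/-- The listed points are distinct indices below `n`. Hence loops over the positions `0, …, n - 1`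
reach the whole list. -/
theorem card_le (h : SearchState M N S φ u L F k Q) (hS : S ⊆ Finset.range n) (hu : u < n) :
    k ≤ n := by
  have hinj : Set.InjOn L (Finset.range k : Set ℕ) := by
    intro i hi j hj e
    simp only [Finset.coe_range, Set.mem_Iio] at hi hj
    rcases lt_trichotomy i j with hij | hij | hij
    · exact absurd e (h.inj j hj i hij)
    · exact hij
    · exact absurd e.symm (h.inj i hi j hij)
  have := Finset.card_le_card_of_injOn (s := Finset.range k) (t := Finset.range n) L (fun i hi => by
    rcases Nat.eq_zero_or_pos i with rfl | h0
    · simpa [h.zero] using hu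
    · exact hS (h.mem i (by simpa using hi) h0)) hinj
  simpa using this

end SearchState

/-- The memory holds the state of a search. -/
abbrev HoldsSearch (M : Matroid ℕ) (N : ℕ → Set ℕ) (S : Finset ℕ) (φ : ℕ → ℕ) (u : ℕ) (s : Memory)
    (Q : ℕ → ℕ → ℕ → Prop) : Prop :=
  SearchState M N S φ u (fun j => s.nat order j 0) (fun j => s.nat seen j 0) (s.nat reached 0 0) Q

theorem HoldsSearch.congr {N : ℕ → Set ℕ} {u : ℕ} {s s' : Memory} {Q : ℕ → ℕ → ℕ → Prop}
    (h : HoldsSearch M N S φ u s Q) (h1 : s'.nat order = s.nat order)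
    (h2 : s'.nat seen = s.nat seen) (h3 : s'.nat reached = s.nat reached) :
    HoldsSearch M N S φ u s' Q := by
  rw [HoldsSearch, h1, h2, h3]; exact h

/-- The list grows only at its end, so the node at the position being processed stays the same
during the inner loops. -/
theorem run_visit_prefix (s : Memory) :
    s.nat reached 0 0 ≤ (visit.run O s).nat reached 0 0 ∧
      ∀ j < s.nat reached 0 0, (visit.run O s).nat order j 0 = s.nat order j 0 := by
  by_cases hc : Test.Holds s
      (.and (nonzero (.entry chosen (.var 25))) (.not (nonzero (.entry seen (.var 25)))))
  swap
  · rw [visit, run_ite_neg hc]; simp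
  rw [visit, run_ite_pos hc]
  let p := assign omitted (.var 25) ;; assign added (.var 24) ;; testIndep
  have h1 : (p.run O s).nat reached = s.nat reached := nat_run _ _ _ (by decide)
  have h2 : (p.run O s).nat order = s.nat order := nat_run _ _ _ (by decide)
  have hrun : ∀ q, (assign omitted (.var 25) ;; assign added (.var 24) ;; testIndep ;; q).run O s
      = q.run O (p.run O s) := fun q => rfl
  rw [hrun]
  generalize p.run O s = s₁ at h1 h2
  rw [← h1, ← h2]
  by_cases ha : s₁.nat answer 0 0 = 0
  · rw [run_ite_neg (by simp [ha])]; simp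
  · rw [run_ite_pos (by simp [ha])]
    refine ⟨by simp [Memory.nat_setNat], fun j hj => ?_⟩
    simp [Memory.nat_setNat, hj.ne]

/-- One more triple is processed: the point `t` is not selected, is already listed, fails the
independence test, or is appended. `hQ` ensures that an appended position has no processed triples.
-/
theorem run_visit (hI : IsInstance O n M D W) (hS : HoldsSelection s n D W m r S φ)
    (hφ : M.Indep (φ '' S)) {N : ℕ → Set ℕ} {u : ℕ} {Q : ℕ → ℕ → ℕ → Prop}
    (h : HoldsSearch M N S φ u s Q) {i x t : ℕ} (hi : i < s.nat reached 0 0)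
    (hx : s.nat 24 0 0 = x) (ht : s.nat 25 0 0 = t) (htn : t < n) (hxn : x < n)
    (hxN : x ∈ N (s.nat order i 0)) (hQ : ∀ j y v, Q j y v → j ≤ i) :
    HoldsSearch M N S φ u (visit.run O s) fun j y v => Q j y v ∨ j = i ∧ y = x ∧ v = t := by
  by_cases hc : t ∈ S ∧ s.nat seen t 0 = 0
  · rw [visit, run_ite_pos (by simp [ht, hc.2, (hS.chosen t htn).2 hc.1])]
    let p := assign omitted (.var 25) ;; assign added (.var 24)
    set s₁ := (p ;; testIndep).run O s with hs₁
    have e₁ : ∀ a, a ∉ (p ;; testIndep).natWrites → s₁.nat a = s.nat a :=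
      fun a ha => nat_run _ _ _ ha
    have htest : s₁.nat answer 0 0 ≠ 0 ↔ x ∉ M.closure (φ '' (S \ {t})) := by
      rw [hs₁, run_seq]
      refine run_testIndep hI (hS.agree (agree_run p s) (by decide) (by decide)) hφ ?_ ?_ hxn
      · simp [p, Memory.nat_setNat, ht]
      · simp [p, Memory.nat_setNat, hx]
    have h₁ : HoldsSearch M N S φ u s₁ Q :=
      h.congr (e₁ _ (by decide)) (e₁ _ (by decide)) (e₁ _ (by decide))
    have hrun : ∀ q, (assign omitted (.var 25) ;; assign added (.var 24) ;; testIndep ;; q).run O s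
        = q.run O s₁ := fun q => rfl
    rw [hrun]
    by_cases ha : s₁.nat answer 0 0 = 0
    · rw [run_ite_neg (by simp [ha])]
      refine { h₁ with closed := fun j hj y hy v hv hq hyv => ?_ }
      obtain hq | ⟨rfl, rfl, rfl⟩ := hq
      · exact h₁.closed j hj y hy v hv hq hyv
      · exact absurd hyv (mt htest.2 (by simpa using ha))
    · rw [run_ite_pos (by simp [ha])]
      have ht' : s₁.nat 25 0 0 = t := by rw [e₁ _ (by decide)]; exact ht
      have ho' : s₁.nat order = s.nat order := e₁ _ (by decide)
      have hr' : s₁.nat reached = s.nat reached := e₁ _ (by decide)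
      have hs' : s₁.nat seen = s.nat seen := e₁ _ (by decide)
      have := h₁.append (i := i) (x := x) (t := t) (by rwa [hr']) (by rwa [ho']) hc.1
        (htest.1 ha) (by rw [hs']; exact hc.2) (fun y v hq => by
          have := hQ _ _ _ hq; rw [hr'] at this; omega)
        (L' := fun j => if j = s₁.nat reached 0 0 then t else s₁.nat order j 0)
        (F' := fun j => if j = t then 1 else s₁.nat seen j 0) (fun _ => rfl) (fun _ => rfl)
      have hfin : HoldsSearch M N S φ u ((store seen (.var 25) (.lit 1) ;;
          store order (.var reached) (.var 25) ;;
          assign reached (.add (.var reached) (.lit 1))).run O s₁) Q := by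
        simpa [HoldsSearch, Memory.nat_setNat, ht'] using this
      refine { hfin with closed := fun j hj y hy v hv hq hyv => ?_ }
      obtain hq | ⟨rfl, rfl, rfl⟩ := hq
      · exact hfin.closed j hj y hy v hv hq hyv
      · refine ⟨s₁.nat reached 0 0, ?_, ?_⟩
        · simp [Memory.nat_setNat]
        · simp [Memory.nat_setNat, ht']
  · rw [visit, run_ite_neg (by simpa [ht] using fun h1 => not_and.1 hc ((hS.chosen t htn).1 h1))]
    refine { h with closed := fun j hj y hy v hv hq hyv => ?_ }
    obtain hq | ⟨rfl, rfl, rfl⟩ := hq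
    · exact h.closed j hj y hy v hv hq hyv
    · exact (h.flag v hv).1 fun h0 => hc ⟨hv, h0⟩

theorem run_search (hI : IsInstance O n M D W) (hS : HoldsSelection s n D W m r S φ)
    (hφ : M.Indep (φ '' S)) {u : ℕ} (hstart : s.nat start 0 0 = u) (hu : u ∉ S) (hun : u < n) :
    HoldsSearch M (vicinity (Finset.range n) D r) S φ u (search.run O s) fun _ _ _ => True := by
  set N := vicinity (Finset.range n) D r with hN
  let p := clear 22 seen ;; store order (.lit 0) (.var start) ;; assign reached (.lit 1)
  set s₁ := p.run O s with hs₁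
  have hS₁ : HoldsSelection s₁ n D W m r S φ := hS.agree (agree_run p s) (by decide) (by decide)
  have h₁ : HoldsSearch M N S φ u s₁ fun i _ _ => i < 0 := by
    have hseen : ∀ i < n, s₁.nat seen i 0 = 0 := by
      intro i hi
      have := run_clear (O := O) (c := 22) (a := seen) (by decide) hS.size i hi
      simpa [hs₁, p, Memory.nat_setNat] using this
    have hord : s₁.nat order 0 0 = u := by
      have := nat_run (O := O) (clear 22 seen) s start (by decide)
      simp [hs₁, p, Memory.nat_setNat, this, hstart]
    have hr : s₁.nat reached 0 0 = 1 := by simp [hs₁, p, Memory.nat_setNat]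
    have hz : ∀ i < 1, i = 0 := fun i hi => by omega
    rw [HoldsSearch, hr]
    refine ⟨by omega, hord, fun i hi hi0 => by omega, fun i hi hi0 => by omega,
      fun i hi j hj => by omega, fun t ht => ?_, fun i hi x hx t ht hq => absurd hq (by simp)⟩
    refine iff_of_false (by simp [hseen t (Finset.mem_range.1 (hS.subset ht))]) ?_
    rintro ⟨i, hi, e⟩
    obtain rfl := hz i hi
    exact hu (by rw [← hord]; exact e ▸ ht)
  -- The list has at most `n` entries, so processing all positions below `n` is complete.
  suffices HoldsSearch M N S φ u (search.run O s) fun i _ _ => i < n by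
    refine this.imp fun i hi _ _ _ _ _ => ?_
    exact hi.trans_le (this.card_le hS.subset hun)
  refine run_loop (s := s₁) (fun k s' => HoldsSearch M N S φ u s' fun i _ _ => i < k) hS₁.size
    (h₁.congr rfl rfl rfl) ?_
  intro i s₂ hi hci hag ih
  have hS₂ := hS₁.agree hag (by decide) (by decide)
  refine HoldsSearch.congr (s := (run O _ s₂)) ?_ (Memory.nat_setNat_of_ne _ (by decide) _ _ _)
    (Memory.nat_setNat_of_ne _ (by decide) _ _ _) (Memory.nat_setNat_of_ne _ (by decide) _ _ _)
  by_cases hik : i < s₂.nat reached 0 0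
  swap
  · rw [run_ite_neg (by simpa [hci] using hik)]
    exact ih.imp fun j hj _ _ _ _ h => by omega
  rw [run_ite_pos (by simpa [hci] using hik)]
  -- The processed triples form an initial segment of the lexicographic order of the three loops.
  have key : i < ((loop 24 visitAll).run O s₂).nat reached 0 0 ∧ HoldsSearch M N S φ u ((loop 24 visitAll).run O s₂)
      (fun j y _ => j < i ∨ j = i ∧ y < n) := by
    refine run_loop (s := s₂) (fun k s' => i < s'.nat reached 0 0 ∧ HoldsSearch M N S φ u s'
      fun j y _ => j < i ∨ j = i ∧ y < k) hS₂.size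
      ⟨by simpa [Memory.nat_setNat] using hik, (ih.congr rfl rfl rfl).imp (by simp)⟩ ?_
    intro x s₃ hx hcx hag₃ ⟨hik₃, ih₃⟩
    have hS₃ := hS₂.agree hag₃ (by decide) (by decide)
    have hci₃ : s₃.nat 23 0 0 = i := by rw [hag₃.nat _ (by decide)]; exact hci
    rw [Memory.nat_setNat_of_ne _ (by decide)]
    suffices h : i < (visitAll.run O s₃).nat reached 0 0 ∧ HoldsSearch M N S φ u (visitAll.run O s₃)
        (fun j y _ => j < i ∨ j = i ∧ y < x + 1) from
      ⟨h.1, h.2.congr (Memory.nat_setNat_of_ne _ (by decide) _ _ _)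
        (Memory.nat_setNat_of_ne _ (by decide) _ _ _)
        (Memory.nat_setNat_of_ne _ (by decide) _ _ _)⟩
    by_cases hxN : x ∈ N (s₃.nat order i 0)
    swap
    · have hxd : ¬ D (s₃.nat order i 0) x ≤ r + r := fun h => hxN ⟨Finset.mem_range.2 hx, h⟩
      rw [visitAll, run_ite_neg (by simpa [hci₃, hcx, hS₃.dist, hS₃.radius] using hxd)]
      refine ⟨hik₃, ih₃.imp fun j hj y hy t ht hq => ?_⟩
      obtain hq | ⟨rfl, hyx⟩ := hq
      · exact .inl hq
      · refine .inr ⟨rfl, ?_⟩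
        have : y ≠ x := fun e => hxN (e ▸ hy)
        omega
    rw [visitAll, run_ite_pos (by simpa [hci₃, hcx, hS₃.dist, hS₃.radius] using hxN.2)]
    have key₃ : (i < (run O (loop 25 visit) s₃).nat reached 0 0 ∧
        (run O (loop 25 visit) s₃).nat order i 0 = s₃.nat order i 0) ∧
        HoldsSearch M N S φ u (run O (loop 25 visit) s₃)
        (fun j y t => j < i ∨ j = i ∧ (y < x ∨ y = x ∧ t < n)) := by
      refine run_loop (s := s₃) (fun k s' => (i < s'.nat reached 0 0 ∧
        s'.nat order i 0 = s₃.nat order i 0) ∧ HoldsSearch M N S φ u s'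
        fun j y t => j < i ∨ j = i ∧ (y < x ∨ y = x ∧ t < k)) hS₃.size
        ⟨⟨by simpa [Memory.nat_setNat] using hik₃, by simp [Memory.nat_setNat]⟩,
          (ih₃.congr rfl rfl rfl).imp (by simp)⟩ ?_
      intro t s₄ ht hct hag₄ ⟨⟨hik₄, ho₄⟩, ih₄⟩
      have hS₄ := hS₃.agree hag₄ (by decide) (by decide)
      have hcx₄ : s₄.nat 24 0 0 = x := by rw [hag₄.nat _ (by decide)]; exact hcx
      have hv := run_visit hI hS₄ hφ ih₄ hik₄ hcx₄ hct ht hx (by rwa [ho₄])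
        (by intro j y v hq; omega)
      rw [Memory.nat_setNat_of_ne _ (by decide), Memory.nat_setNat_of_ne _ (by decide)]
      refine ⟨?_, (hv.congr (Memory.nat_setNat_of_ne _ (by decide) _ _ _)
        (Memory.nat_setNat_of_ne _ (by decide) _ _ _)
        (Memory.nat_setNat_of_ne _ (by decide) _ _ _)).imp ?_⟩
      · obtain ⟨h1, h2⟩ := run_visit_prefix (O := O) s₄
        exact ⟨by omega, by rw [h2 i hik₄, ho₄]⟩
      · intro j _ y _ v _ hq
        omega
    exact ⟨key₃.1.1, key₃.2.imp fun j hj y hy t ht hq => by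
      have := Finset.mem_range.1 (hS.subset ht); omega⟩
  exact key.2.imp fun j hj y hy t ht hq => by
    have := Finset.mem_range.1 hy.1; omega


/-! ### Finding the first exit and deciding extendability. -/

/-- The memory holds an exit, the first one in the list `L`. -/
def HoldsExit (M : Matroid ℕ) (N : ℕ → Set ℕ) (S : Finset ℕ) (φ : ℕ → ℕ) (L : ℕ → ℕ) (k : ℕ)
    (s : Memory) : Prop :=
  s.nat found 0 0 ≠ 0 ∧ ∃ i < k, s.nat exitNode 0 0 = L i ∧ s.nat exitElem 0 0 ∈ N (L i) ∧
    s.nat exitElem 0 0 ∉ M.closure (φ '' S) ∧ ∀ j < i, ¬ IsExit M N S φ (L j)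

theorem HoldsExit.congr {N : ℕ → Set ℕ} {L : ℕ → ℕ} {k : ℕ} {s s' : Memory}
    (h : HoldsExit M N S φ L k s) (h1 : s'.nat found = s.nat found)
    (h2 : s'.nat exitNode = s.nat exitNode) (h3 : s'.nat exitElem = s.nat exitElem) :
    HoldsExit M N S φ L k s' := by
  rw [HoldsExit, h1, h2, h3]; exact h

/-- Once `found` is set, the record is frozen. While it is not set, all earlier positions are known
not to be exits, so a hit at position `i` is the first exit. -/
theorem run_checkExit (hI : IsInstance O n M D W) (hS : HoldsSelection s n D W m r S φ)
    (hφ : M.Indep (φ '' S)) {i k x : ℕ} (hik : i < k) (hi : s.nat 26 0 0 = i)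
    (hx : s.nat 27 0 0 = x) (hxn : x < n)
    (h : s.nat found 0 0 = 0 → ∀ j < i, ¬ IsExit M (vicinity (Finset.range n) D r) S φ
      (s.nat order j 0))
    (h' : s.nat found 0 0 ≠ 0 → HoldsExit M (vicinity (Finset.range n) D r) S φ
      (fun j => s.nat order j 0) k s) :
    let s' := checkExit.run O s
    (s'.nat found 0 0 = 0 → s.nat found 0 0 = 0 ∧
      (x ∈ vicinity (Finset.range n) D r (s.nat order i 0) → x ∈ M.closure (φ '' S))) ∧
    (s'.nat found 0 0 ≠ 0 → HoldsExit M (vicinity (Finset.range n) D r) S φ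
      (fun j => s.nat order j 0) k s') := by
  intro s'
  by_cases hc : s.nat found 0 0 = 0 ∧ D (s.nat order i 0) x ≤ r + r
  · have hs' : s' = checkExit.run O s := rfl
    rw [checkExit, run_ite_pos (by simpa [hi, hx, hS.dist, hS.radius] using hc)] at hs'
    let p := assign omitted (.var 0) ;; assign added (.var 27)
    set s₁ := (p ;; testIndep).run O s with hs₁
    have e₁ : ∀ a, a ∉ (p ;; testIndep).natWrites → s₁.nat a = s.nat a :=
      fun a ha => nat_run _ _ _ ha
    have htest : s₁.nat answer 0 0 ≠ 0 ↔ x ∉ M.closure (φ '' S) := by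
      -- The omitted index is `n`, which lies outside `S`.
      have hn : (S : Set ℕ) \ {n} = S := Set.sdiff_singleton_eq_self fun h => by
        simpa using hS.subset h
      rw [hs₁, run_seq]
      conv_rhs => rw [← hn]
      refine run_testIndep hI (hS.agree (agree_run p s) (by decide) (by decide)) hφ ?_ ?_ hxn
      · simp [p, Memory.nat_setNat, hS.size]
      · simp [p, Memory.nat_setNat, hx]
    have hrun : ∀ q, (assign omitted (.var 0) ;; assign added (.var 27) ;; testIndep ;; q).run O s
        = q.run O s₁ := fun q => rfl
    rw [hrun] at hs'
    by_cases ha : s₁.nat answer 0 0 = 0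
    · rw [run_ite_neg (by simp [ha])] at hs'
      have hf : s'.nat found 0 0 = 0 := by
        rw [hs']; simp only [run]; rw [e₁ _ (by decide)]; exact hc.1
      exact ⟨fun _ => ⟨hc.1, fun _ => by_contra fun h => htest.2 h ha⟩, fun h => absurd hf h⟩
    · rw [run_ite_pos (by simp [ha])] at hs'
      have h1 : s'.nat found 0 0 = 1 := by rw [hs']; simp [Memory.nat_setNat]
      have h2 : s'.nat exitNode 0 0 = s.nat order i 0 := by
        rw [hs']
        simp [Memory.nat_setNat, e₁ 26 (by decide), e₁ order (by decide), hi]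
      have h3 : s'.nat exitElem 0 0 = x := by
        rw [hs']
        simp [Memory.nat_setNat, e₁ 27 (by decide), hx]
      refine ⟨fun h0 => by omega, fun _ => ⟨by omega, i, hik, h2, ?_, ?_, h hc.1⟩⟩
      · rw [h3]; exact ⟨Finset.mem_range.2 hxn, hc.2⟩
      · rw [h3]; exact htest.1 ha
  · have hs' : s' = s := by
      change checkExit.run O s = s
      rw [checkExit, run_ite_neg (by simpa [hi, hx, hS.dist, hS.radius] using hc)]
      rfl
    rw [hs']
    exact ⟨fun h0 => ⟨h0, fun hxN => absurd ⟨h0, hxN.2⟩ hc⟩, h'⟩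

theorem run_findExit (hI : IsInstance O n M D W) (hS : HoldsSelection s n D W m r S φ)
    (hφ : M.Indep (φ '' S)) {L : ℕ → ℕ} {k : ℕ} (hL : ∀ j, s.nat order j 0 = L j)
    (hk : s.nat reached 0 0 = k) (hkn : k ≤ n) :
    ((findExit.run O s).nat found 0 0 = 0 →
      ∀ j < k, ¬ IsExit M (vicinity (Finset.range n) D r) S φ (L j)) ∧
    ((findExit.run O s).nat found 0 0 ≠ 0 →
      HoldsExit M (vicinity (Finset.range n) D r) S φ L k (findExit.run O s)) := by
  obtain rfl : (fun j => s.nat order j 0) = L := funext hL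
  set N := vicinity (Finset.range n) D r with hN
  set s₁ := (assign found (.lit 0)).run O s with hs₁
  have hS₁ : HoldsSelection s₁ n D W m r S φ := hS.agree (agree_run _ s) (by decide) (by decide)
  have e₁ : ∀ a, a ≠ found → s₁.nat a = s.nat a := fun a ha => Memory.nat_setNat_of_ne _ ha _ _ _
  suffices h : ((findExit.run O s).nat found 0 0 = 0 →
      ∀ j < n, j < k → ¬ IsExit M N S φ (s.nat order j 0)) ∧
    ((findExit.run O s).nat found 0 0 ≠ 0 →
      HoldsExit M N S φ (fun j => s.nat order j 0) k (findExit.run O s)) from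
    ⟨fun h0 j hj => h.1 h0 j (by omega) hj, h.2⟩
  refine run_loop (s := s₁) (fun l s' => (s'.nat found 0 0 = 0 →
      ∀ j < l, j < k → ¬ IsExit M N S φ (s.nat order j 0)) ∧
    (s'.nat found 0 0 ≠ 0 → HoldsExit M N S φ (fun j => s.nat order j 0) k s')) hS₁.size
    ⟨fun _ j hj => absurd hj (by omega), fun h => absurd (by simp [hs₁, Memory.nat_setNat]) h⟩ ?_
  intro i s₂ hi hci hag ⟨ih, ih'⟩
  have hS₂ := hS₁.agree hag (by decide) (by decide)
  have ho₂ : s₂.nat order = s.nat order := by rw [hag.nat _ (by decide), e₁ _ (by decide)]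
  have hr₂ : s₂.nat reached 0 0 = k := by rw [hag.nat _ (by decide), e₁ _ (by decide), hk]
  suffices h : ∀ s', s' = (ite (ltNat (.var 26) (.var reached)) (loop 27 checkExit) skip).run O s₂ →
      (s'.nat found 0 0 = 0 → ∀ j < i + 1, j < k → ¬ IsExit M N S φ (s.nat order j 0)) ∧
      (s'.nat found 0 0 ≠ 0 → HoldsExit M N S φ (fun j => s.nat order j 0) k s') by
    obtain ⟨h1, h2⟩ := h _ rfl
    rw [Memory.nat_setNat_of_ne _ (by decide)]
    exact ⟨h1, fun h0 => (h2 h0).congr (Memory.nat_setNat_of_ne _ (by decide) _ _ _)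
      (Memory.nat_setNat_of_ne _ (by decide) _ _ _) (Memory.nat_setNat_of_ne _ (by decide) _ _ _)⟩
  rintro s' rfl
  by_cases hik : i < k
  swap
  · rw [run_ite_neg (by simpa [hci, hr₂] using hik)]
    exact ⟨fun h0 j hj hjk => ih h0 j (by omega) hjk, ih'⟩
  rw [run_ite_pos (by simpa [hci, hr₂] using hik)]
  have key : (((loop 27 checkExit).run O s₂).nat found 0 0 = 0 →
        (∀ j < i, ¬ IsExit M N S φ (s.nat order j 0)) ∧
          ∀ x < n, x ∈ N (s.nat order i 0) → x ∈ M.closure (φ '' S)) ∧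
      (((loop 27 checkExit).run O s₂).nat found 0 0 ≠ 0 →
        HoldsExit M N S φ (fun j => s.nat order j 0) k ((loop 27 checkExit).run O s₂)) := by
    refine run_loop (s := s₂) (fun l s' => (s'.nat found 0 0 = 0 →
        (∀ j < i, ¬ IsExit M N S φ (s.nat order j 0)) ∧
          ∀ x < l, x ∈ N (s.nat order i 0) → x ∈ M.closure (φ '' S)) ∧
      (s'.nat found 0 0 ≠ 0 → HoldsExit M N S φ (fun j => s.nat order j 0) k s')) hS₂.size ?_ ?_
    · rw [Memory.nat_setNat_of_ne _ (by decide)]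
      exact ⟨fun h0 => ⟨fun j hj => ih h0 j hj (by omega), fun x hx => absurd hx (by omega)⟩,
        fun h0 => (ih' h0).congr rfl rfl rfl⟩
    · intro x s₃ hx hcx hag₃ ⟨ih₃, ih₃'⟩
      have hS₃ := hS₂.agree hag₃ (by decide) (by decide)
      have ho₃ : s₃.nat order = s.nat order := by rw [hag₃.nat _ (by decide), ho₂]
      have hci₃ : s₃.nat 26 0 0 = i := by rw [hag₃.nat _ (by decide)]; exact hci
      have := run_checkExit hI hS₃ hφ hik hci₃ hcx hx (by rw [ho₃]; exact fun h0 => (ih₃ h0).1)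
        (by rw [ho₃]; exact ih₃')
      rw [ho₃] at this
      rw [Memory.nat_setNat_of_ne _ (by decide)]
      refine ⟨fun h0 => ⟨(ih₃ (this.1 h0).1).1, fun y hy hyN => ?_⟩, fun h0 => ?_⟩
      · obtain hy | rfl := Nat.lt_succ_iff_lt_or_eq.1 hy
        · exact (ih₃ (this.1 h0).1).2 y hy hyN
        · exact (this.1 h0).2 hyN
      · exact (this.2 h0).congr (Memory.nat_setNat_of_ne _ (by decide) _ _ _)
          (Memory.nat_setNat_of_ne _ (by decide) _ _ _)
          (Memory.nat_setNat_of_ne _ (by decide) _ _ _)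
  refine ⟨fun h0 j hj hjk => ?_, key.2⟩
  obtain hj | rfl := Nat.lt_succ_iff_lt_or_eq.1 hj
  · exact (key.1 h0).1 j hj
  · rintro ⟨x, hx, hx'⟩
    exact hx' ((key.1 h0).2 x (Finset.mem_range.1 hx.1) hx)

/-- The search followed by the search for an exit decides whether `start` can be added. -/
theorem run_search_findExit (hI : IsInstance O n M D W) (hS : HoldsSelection s n D W m r S φ)
    (hφ : IsTransversal M (vicinity (Finset.range n) D r) S φ) {u : ℕ}
    (hstart : s.nat start 0 0 = u) (hu : u ∉ S) (hun : u < n)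
    (h0 : ((search ;; findExit).run O s).nat found 0 0 = 0) :
    ¬ HasTransversal M (vicinity (Finset.range n) D r) (insert u S) ∅ := by
  set N := vicinity (Finset.range n) D r with hN
  have hs := run_search hI hS hφ.indep hstart hu hun
  have hS₁ := hS.agree (agree_run (O := O) search s) (by decide) (by decide)
  rw [run_seq] at h0
  generalize search.run O s = s₁ at *
  have hk := hs.card_le hS.subset hun
  obtain ⟨h1, -⟩ := run_findExit hI hS₁ hφ.indep (fun _ => rfl) rfl hk
  have h1 := h1 h0
  rintro ⟨ψ, hψ, -⟩
  -- The certificate is the set of all points reached.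
  refine hφ.not_of_closed hu (J := (Finset.range (s₁.nat reached 0 0)).image
    fun j => s₁.nat order j 0) ?_ ?_ ?_ ?_ hψ
  · intro v hv
    obtain ⟨j, hj, rfl⟩ := Finset.mem_image.1 hv
    rcases Nat.eq_zero_or_pos j with rfl | hj0
    · exact Finset.mem_insert.2 (.inl hs.zero)
    · exact Finset.mem_insert_of_mem (hs.mem j (Finset.mem_range.1 hj) hj0)
  · exact Finset.mem_image.2 ⟨0, Finset.mem_range.2 hs.pos, hs.zero⟩
  · intro v hv x hx
    obtain ⟨j, hj, rfl⟩ := Finset.mem_image.1 hv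
    exact by_contra fun hx' => h1 j (Finset.mem_range.1 hj) ⟨x, hx, hx'⟩
  · intro v hv x hx t ht hxt
    obtain ⟨j, hj, rfl⟩ := Finset.mem_image.1 hv
    obtain ⟨l, hl, e⟩ := hs.closed j (Finset.mem_range.1 hj) x hx t ht trivial hxt
    exact Finset.mem_image.2 ⟨l, Finset.mem_range.2 hl, e⟩

/-! ### Correctness of the augmentation. -/

theorem vicinity_subset_ground (hI : IsInstance O n M D W) (v : ℕ) :
    vicinity (Finset.range n) D r v ⊆ M.E := by
  rw [hI.ground]
  exact fun x hx => Finset.mem_range.1 hx.1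

/-- The augmentation succeeds if the search has found an exit. -/
theorem run_augment (hI : IsInstance O n M D W) (hS : HoldsSelection s n D W m r S φ)
    (hφ : IsTransversal M (vicinity (Finset.range n) D r) S φ) {u : ℕ}
    (hstart : s.nat start 0 0 = u) (hu : u ∉ S) (hun : u < n)
    (hs : HoldsSearch M (vicinity (Finset.range n) D r) S φ u s fun _ _ _ => True)
    (hex : ∃ j < s.nat reached 0 0, IsExit M (vicinity (Finset.range n) D r) S φ
      (s.nat order j 0)) :
    ∃ ψ, HoldsSelection (augment.run O s) n D W m r (insert u S) ψ ∧
      IsTransversal M (vicinity (Finset.range n) D r) (insert u S) ψ := by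
  set N := vicinity (Finset.range n) D r with hN
  have hkn := hs.card_le hS.subset hun
  set L := fun j => s.nat order j 0 with hL
  set s₁ := (assign finished (.lit 0)).run O s with hs₁
  have hS₁ : HoldsSelection s₁ n D W m r S φ := hS.agree (agree_run _ s) (by decide) (by decide)
  have e₁ : ∀ a, a ≠ finished → s₁.nat a = s.nat a := fun a ha =>
    Memory.nat_setNat_of_ne _ ha _ _ _
  let body := ite (nonzero (.var finished)) skip
    (findExit ;;
      store rep (.var exitNode) (.var exitElem) ;;
      ite (eqNat (.var exitNode) (.var start)) (assign finished (.lit 1)) skip)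
  -- After `t` unfinished rounds there is an exit at a position `k` with `k + t < n`, which is
  -- impossible for `t = n`.
  let Partial : ℕ → Memory → Prop := fun t s' => s'.nat finished 0 0 = 0 ∧
    ∃ ψ, HoldsSelection s' n D W m r S ψ ∧ IsTransversal M N S ψ ∧
      ∃ k, k + t < n ∧ k < s.nat reached 0 0 ∧ IsSearch M N S ψ u L k ∧ IsExit M N S ψ (L k)
  -- `u` has its representative but is not yet flagged as chosen, so the memory still holds the
  -- selection `S`.
  let Complete : Memory → Prop := fun s' => s'.nat finished 0 0 ≠ 0 ∧
    ∃ ψ, HoldsSelection s' n D W m r S ψ ∧ s'.nat rep u 0 = ψ u ∧ IsTransversal M N (insert u S) ψ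
  have key : Partial n ((loop 28 body).run O s₁) ∨ Complete ((loop 28 body).run O s₁) := by
    refine run_loop (s := s₁) (fun t s' => Partial t s' ∨ Complete s') hS₁.size ?_ ?_
    · obtain ⟨k, hk, hke⟩ := hex
      refine .inl ⟨by simp [hs₁, Memory.nat_setNat], φ,
        hS₁.setNat (by decide) .., hφ, k,
        by omega, hk, ⟨hs.zero, fun i hi => hs.mem i (by omega),
          fun i hi => hs.reach i (by omega)⟩, hke⟩
    · intro t s₂ ht hct hag ih
      have hcounter : ∀ s' : Memory, Partial (t + 1) s' ∨ Complete s' →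
          Partial (t + 1) (s'.setNat 28 0 0 (t + 1)) ∨ Complete (s'.setNat 28 0 0 (t + 1)) := by
        intro s' h
        have hf : (s'.setNat 28 0 0 (t + 1)).nat finished = s'.nat finished :=
          Memory.nat_setNat_of_ne _ (by decide) _ _ _
        have hp : (s'.setNat 28 0 0 (t + 1)).nat rep = s'.nat rep :=
          Memory.nat_setNat_of_ne _ (by decide) _ _ _
        rcases h with ⟨h1, ψ, h2, h3⟩ | ⟨h1, ψ, h2, h3⟩
        · exact .inl ⟨by rw [hf]; exact h1, ψ, h2.setNat (by decide) .., h3⟩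
        · exact .inr ⟨by rw [hf]; exact h1, ψ, h2.setNat (by decide) ..,
            by rw [hp]; exact h3⟩
      refine hcounter _ ?_
      rcases ih with ⟨h1, ψ, hSψ, hψ, k, hkt, hk, hsk, hek⟩ | h
      swap
      · rw [run_ite_pos (by simpa using h.1)]
        exact .inr h
      rw [run_ite_neg (by simpa using h1)]
      have hst₂ : s₂.nat start 0 0 = u := by
        rw [hag.nat _ (by decide), e₁ _ (by decide)]; exact hstart
      have ho₂ : ∀ j, s₂.nat order j 0 = L j := by
        intro j; rw [hag.nat _ (by decide), e₁ _ (by decide)]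
      have hr₂ : s₂.nat reached 0 0 = s.nat reached 0 0 := by
        rw [hag.nat _ (by decide), e₁ _ (by decide)]
      have hfind := run_findExit hI hSψ hψ.indep ho₂ hr₂ hkn
      rw [run_seq]
      have hS₃ := hSψ.agree (agree_run (O := O) findExit s₂) (by decide) (by decide)
      have hst₃ : (findExit.run O s₂).nat start 0 0 = u := by
        rw [nat_run _ _ _ (by decide)]; exact hst₂
      have hf₃ : (findExit.run O s₂).nat finished 0 0 = 0 := by
        rw [nat_run _ _ _ (by decide)]; exact h1
      generalize findExit.run O s₂ = s₃ at *
      have hfound : s₃.nat found 0 0 ≠ 0 := fun h0 => hfind.1 h0 k hk hek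
      obtain ⟨-, i, hi, hnode, hx, hx', hfirst⟩ := hfind.2 hfound
      -- The recorded exit is the first one, hence not after the known exit `k`.
      have hik : i ≤ k := by
        by_contra h; exact hfirst k (by omega) hek
      have hsi : IsSearch M N S ψ u L i :=
        ⟨hsk.zero, fun j hj => hsk.mem j (by omega), fun j hj => hsk.reach j (by omega)⟩
      set x := s₃.nat exitElem 0 0 with hxdef
      rw [run_seq]
      set s₄ := (store rep (.var exitNode) (.var exitElem)).run O s₃ with hs₄
      have e₄ : ∀ v, s₄.nat rep v 0 = Function.update ψ (L i) x v ∨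
          (v ∉ S ∧ v ≠ L i) := by
        intro v
        by_cases hv : v = L i
        · left; simp [hs₄, Memory.nat_setNat, hnode, hv, hxdef]
        · by_cases hvS : v ∈ S
          · left; simpa [hs₄, Memory.nat_setNat, hnode, hv] using hS₃.rep v hvS
          · exact .inr ⟨hvS, hv⟩
      have e₄' : ∀ a, a ≠ rep → s₄.nat a = s₃.nat a := fun a ha =>
        Memory.nat_setNat_of_ne _ ha _ _ _
      have hS₄ : HoldsSelection s₄ n D W m r S (Function.update ψ (L i) x) :=
        { hS₃.toHoldsInstance.agree (agree_run (O := O)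
            (store rep (.var exitNode) (.var exitElem)) s₃) (by decide) (by decide) with
          radius := hS₃.radius
          subset := hS₃.subset
          chosen := by rw [e₄' _ (by decide)]; exact hS₃.chosen
          rep := fun v hv => (e₄ v).resolve_right fun h => h.1 hv }
      have hn₄ : s₄.nat exitNode 0 0 = L i := by rw [e₄' _ (by decide)]; exact hnode
      have hst₄ : s₄.nat start 0 0 = u := by rw [e₄' _ (by decide)]; exact hst₃
      -- At position `0` the exit is `u` itself, which gains a representative; at any other position
      -- a selected point moves and an earlier exit appears.
      rcases Nat.eq_zero_or_pos i with rfl | hi0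
      · have hL0 : L 0 = u := hs.zero
        rw [run_ite_pos (by simp [hn₄, hst₄, hL0])]
        rw [hL0] at hx hS₄ e₄
        refine .inr ⟨by simp [Memory.nat_setNat], Function.update ψ u x, hS₄.agree (agree_run _ _) (by decide)
          (by decide), ?_, hψ.update_insert hu hx (hψ.notMem_image hx')
            (hψ.indep_insert (vicinity_subset_ground hI u hx) hx')⟩
        have := (e₄ u).resolve_right fun h => h.2 rfl
        simpa [Memory.nat_setNat] using this
      · have hne : L i ≠ u := fun e => hu (e ▸ hsi.mem i le_rfl hi0)
        rw [run_ite_neg (by simpa [hn₄, hst₄] using hne)]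
        obtain ⟨hψ', j, hj, hsj, hej⟩ := hsi.exists_exit_update hψ
          (vicinity_subset_ground hI) hi0 hfirst hx hx'
        exact .inl ⟨by simp only [run]; rw [e₄' _ (by decide)]; exact hf₃, _, hS₄, hψ', j,
          by omega, by omega, hsj, hej⟩
  obtain ⟨-, -, -, -, k, hk, -⟩ | ⟨-, ψ, hSψ, hrep, hψ⟩ := key
  · omega
  refine ⟨ψ, ?_, hψ⟩
  have hst : ((loop 28 body).run O s₁).nat start 0 0 = u := by
    rw [nat_run _ _ _ (by decide), e₁ _ (by decide)]; exact hstart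
  have hrun : augment.run O s = (store chosen (.var start) (.lit 1)).run O
    ((loop 28 body).run O s₁) := rfl
  rw [hrun]
  generalize (loop 28 body).run O s₁ = s₂ at *
  have hch : ((store chosen (.var start) (.lit 1)).run O s₂).nat rep = s₂.nat rep :=
    Memory.nat_setNat_of_ne _ (by decide) _ _ _
  exact
    { hSψ.toHoldsInstance.agree (agree_run (O := O)
        (store chosen (.var start) (.lit 1)) s₂) (by decide) (by decide) with
      radius := hSψ.radius
      subset := Finset.insert_subset (Finset.mem_range.2 hun) hSψ.subset
      chosen := by
        intro i hi
        by_cases h : i = u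
        · simp [Memory.nat_setNat, hst, h]
        · simpa [Memory.nat_setNat, hst, h] using hSψ.chosen i hi
      rep := by
        intro v hv
        rw [hch]
        obtain rfl | hv := Finset.mem_insert.1 hv
        · exact hrep
        · exact hSψ.rep v hv }


/-! ### One greedy step. -/

/-- The point `u` can be added to the selection `S`. -/
abbrev IsCandidate (n : ℕ) (M : Matroid ℕ) (D : ℕ → ℕ → ℝ) (r : ℝ) (S : Finset ℕ) (u : ℕ) : Prop :=
  HasTransversal M (vicinity (Finset.range n) D r) (insert u S) ∅

/-- The weight that the cluster of `u` adds to the covered points. -/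
noncomputable abbrev gainOf (n : ℕ) (D : ℕ → ℕ → ℝ) (W : ℕ → ℝ) (r : ℝ) (Cov : Finset ℕ) (u : ℕ) :
    ℝ :=
  ∑ v ∈ coverIn (Finset.range n) D {u} r \ Cov, W v

theorem exists_exit_of_found (hI : IsInstance O n M D W) (hS : HoldsSelection s n D W m r S φ)
    (hφ : IsTransversal M (vicinity (Finset.range n) D r) S φ) {u : ℕ}
    (hstart : s.nat start 0 0 = u) (hu : u ∉ S) (hun : u < n)
    (h0 : ((search ;; findExit).run O s).nat found 0 0 ≠ 0) :
    ∃ j < (search.run O s).nat reached 0 0, IsExit M (vicinity (Finset.range n) D r) S φ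
      ((search.run O s).nat order j 0) := by
  have hs := run_search hI hS hφ.indep hstart hu hun
  have hS₁ := hS.agree (agree_run (O := O) search s) (by decide) (by decide)
  rw [run_seq] at h0
  obtain ⟨-, h1⟩ := run_findExit hI hS₁ hφ.indep (fun _ => rfl) rfl (hs.card_le hS.subset hun)
  obtain ⟨-, i, hi, -, hx, hx', -⟩ := h1 h0
  exact ⟨i, hi, _, hx, hx'⟩

theorem run_search_augment (hI : IsInstance O n M D W) (hS : HoldsSelection s n D W m r S φ)
    (hφ : IsTransversal M (vicinity (Finset.range n) D r) S φ) {u : ℕ}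
    (hstart : s.nat start 0 0 = u) (hu : u ∉ S) (hun : u < n)
    (h0 : ((search ;; findExit).run O s).nat found 0 0 ≠ 0) :
    ∃ ψ, HoldsSelection ((search ;; augment).run O s) n D W m r (insert u S) ψ ∧
      IsTransversal M (vicinity (Finset.range n) D r) (insert u S) ψ :=
  run_augment hI (hS.agree (agree_run (O := O) search s) (by decide) (by decide)) hφ
    (by rw [nat_run _ _ _ (by decide)]; exact hstart) hu hun
    (run_search hI hS hφ.indep hstart hu hun)
    (exists_exit_of_found hI hS hφ hstart hu hun h0)

/-- If an exit is found, the augmentation itself constructs the larger transversal; if not, the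
reached set certifies that there is none. -/
theorem found_iff (hI : IsInstance O n M D W) (hS : HoldsSelection s n D W m r S φ)
    (hφ : IsTransversal M (vicinity (Finset.range n) D r) S φ) {u : ℕ}
    (hstart : s.nat start 0 0 = u) (hu : u ∉ S) (hun : u < n) :
    ((search ;; findExit).run O s).nat found 0 0 ≠ 0 ↔ IsCandidate n M D r S u := by
  refine ⟨fun h0 => ?_, fun h h0 => run_search_findExit hI hS hφ hstart hu hun h0 h⟩
  obtain ⟨ψ, -, hψ⟩ := run_search_augment hI hS hφ hstart hu hun h0
  exact hψ.hasTransversal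

/-- The memory holds the set of covered points. -/
structure HoldsCover (s : Memory) (n : ℕ) (Cov : Finset ℕ) : Prop where
  subset : Cov ⊆ Finset.range n
  covered : ∀ i < n, s.nat covered i 0 ≠ 0 ↔ i ∈ Cov

theorem HoldsCover.congr {s s' : Memory} (h : HoldsCover s n Cov)
    (e : s'.nat LoopProgram.covered = s.nat LoopProgram.covered) : HoldsCover s' n Cov :=
  ⟨h.subset, by rw [e]; exact h.covered⟩

/-- The memory holds the best candidate among the points in `U`. -/
def HoldsBest (n : ℕ) (M : Matroid ℕ) (D : ℕ → ℕ → ℝ) (W : ℕ → ℝ) (r : ℝ) (S Cov : Finset ℕ)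
    (k : ℕ) (s : Memory) : Prop :=
  (s.nat hasBest 0 0 = 0 ∧ ∀ u < k, u ∉ S → ¬ IsCandidate n M D r S u) ∨
  (s.nat hasBest 0 0 ≠ 0 ∧ ∃ b < n, s.nat best 0 0 = b ∧ b ∉ S ∧ IsCandidate n M D r S b ∧
    s.real bestGain 0 0 = gainOf n D W r Cov b ∧
    ∀ u < k, u ∉ S → IsCandidate n M D r S u → gainOf n D W r Cov u ≤ gainOf n D W r Cov b)

theorem HoldsBest.congr {s s' : Memory} {k : ℕ} (h : HoldsBest n M D W r S Cov k s)
    (h1 : s'.nat hasBest = s.nat hasBest) (h2 : s'.nat best = s.nat best)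
    (h3 : s'.real bestGain = s.real bestGain) : HoldsBest n M D W r S Cov k s' := by
  rw [HoldsBest, h1, h2, h3]; exact h

theorem HoldsBest.succ {s : Memory} {k : ℕ} (h : HoldsBest n M D W r S Cov k s)
    (hk : ¬ (k ∉ S ∧ IsCandidate n M D r S k)) : HoldsBest n M D W r S Cov (k + 1) s := by
  rcases h with ⟨h1, h2⟩ | ⟨h1, b, hb, h2, h3, h4, h5, h6⟩
  · refine .inl ⟨h1, fun u hu huS hc => ?_⟩
    obtain hu | rfl := Nat.lt_succ_iff_lt_or_eq.1 hu
    · exact h2 u hu huS hc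
    · exact hk ⟨huS, hc⟩
  · refine .inr ⟨h1, b, hb, h2, h3, h4, h5, fun u hu huS hc => ?_⟩
    obtain hu | rfl := Nat.lt_succ_iff_lt_or_eq.1 hu
    · exact h6 u hu huS hc
    · exact absurd ⟨huS, hc⟩ hk

theorem run_gain (hS : HoldsSelection s n D W m r S φ) (hC : HoldsCover s n Cov) {u : ℕ}
    (hstart : s.nat start 0 0 = u) :
    ((sumWeights 29 gain (.and (.not (nonzero (.entry covered (.var 29))))
      (.leReal (distance (.var start) (.var 29)) (realVar radius)))).run O s).real gain 0 0 =
      gainOf n D W r Cov u := by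
  refine run_sumWeights (by decide) hS.size hS.weight
    (fun v hv => (mem_coverIn.1 (Finset.mem_sdiff.1 hv).1).1) fun i s' hi hc hag => ?_
  have h1 : s'.nat covered = s.nat covered := hag.nat _ (by simp [sumWeights, natWrites])
  have h2 : s'.nat start = s.nat start := hag.nat _ (by simp [sumWeights, natWrites])
  have h3 : s'.real 0 = D := (hag.real _ (by simp [sumWeights, realWrites])).trans hS.dist
  have h4 : s'.real radius 0 0 = r := by
    rw [hag.real _ (by simp [sumWeights, realWrites])]; exact hS.radius
  have h5 := hC.covered i hi
  simp [hc, h1, h2, h3, h4, hstart, mem_coverIn, hi]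
  tauto

theorem run_selectBest (hI : IsInstance O n M D W) (hS : HoldsSelection s n D W m r S φ)
    (hφ : IsTransversal M (vicinity (Finset.range n) D r) S φ) (hC : HoldsCover s n Cov) :
    HoldsBest n M D W r S Cov n (selectBest.run O s) := by
  set s₁ := (assign hasBest (.lit 0)).run O s with hs₁
  have hS₁ : HoldsSelection s₁ n D W m r S φ := hS.setNat (by decide) ..
  have hC₁ : HoldsCover s₁ n Cov := hC.congr (Memory.nat_setNat_of_ne _ (by decide) _ _ _)
  refine run_loop (s := s₁) (fun k s' => HoldsBest n M D W r S Cov k s') hS₁.size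
    (.inl ⟨by simp [hs₁, Memory.nat_setNat], fun u hu => absurd hu (by omega)⟩) ?_
  intro u s₂ hun hcu hag ih
  have hS₂ := hS₁.agree hag (by decide) (by decide)
  have hC₂ : HoldsCover s₂ n Cov := hC₁.congr (hag.nat _ (by decide))
  refine HoldsBest.congr (s := LoopProgram.run O _ s₂) ?_
    (Memory.nat_setNat_of_ne _ (by decide) _ _ _) (Memory.nat_setNat_of_ne _ (by decide) _ _ _) rfl
  by_cases hu : u ∈ S
  · rw [run_ite_pos (by simpa [hcu] using (hS₂.chosen u hun).2 hu)]
    exact ih.succ fun h => h.1 hu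
  rw [run_ite_neg (by simpa [hcu] using mt (hS₂.chosen u hun).1 hu), run_seq]
  set s₃ := (assign start (.var 30)).run O s₂ with hs₃
  have hS₃ : HoldsSelection s₃ n D W m r S φ := hS₂.setNat (by decide) ..
  have hst₃ : s₃.nat start 0 0 = u := by simp [hs₃, Memory.nat_setNat, hcu]
  have hC₃ : HoldsCover s₃ n Cov := hC₂.congr (Memory.nat_setNat_of_ne _ (by decide) _ _ _)
  have ih₃ : HoldsBest n M D W r S Cov u s₃ := ih.congr
    (Memory.nat_setNat_of_ne _ (by decide) _ _ _) (Memory.nat_setNat_of_ne _ (by decide) _ _ _) rfl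
  have hfound := found_iff hI hS₃ hφ hst₃ hu hun
  rw [run_seq, run_seq, ← run_seq search]
  have hag₄ := agree_run (O := O) (search ;; findExit) s₃
  generalize (search ;; findExit).run O s₃ = s₄ at *
  have hS₄ := hS₃.agree hag₄ (by decide) (by decide)
  have hC₄ : HoldsCover s₄ n Cov := hC₃.congr (hag₄.nat _ (by decide))
  have hst₄ : s₄.nat start 0 0 = u := by rw [hag₄.nat _ (by decide)]; exact hst₃
  have ih₄ : HoldsBest n M D W r S Cov u s₄ := ih₃.congr
    (hag₄.nat _ (by decide)) (hag₄.nat _ (by decide)) (hag₄.real _ (by decide))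
  by_cases hf : s₄.nat found 0 0 = 0
  · rw [run_ite_neg (by simpa using hf)]
    exact ih₄.succ fun h => hfound.2 h.2 hf
  rw [run_ite_pos (by simpa using hf), run_seq]
  have hcand := hfound.1 hf
  have hgain := run_gain (O := O) hS₄ hC₄ hst₄
  have hag₅ := agree_run (O := O) (sumWeights 29 gain
    (.and (.not (nonzero (.entry covered (.var 29))))
      (.leReal (distance (.var start) (.var 29)) (realVar radius)))) s₄
  generalize LoopProgram.run O (sumWeights _ _ _) s₄ = s₅ at *
  have ih₅ : HoldsBest n M D W r S Cov u s₅ := ih₄.congr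
    (hag₅.nat _ (by decide)) (hag₅.nat _ (by decide)) (hag₅.real _ (by decide))
  have hst₅ : s₅.nat start 0 0 = u := by rw [hag₅.nat _ (by decide)]; exact hst₄
  by_cases hbest : s₅.nat hasBest 0 0 ≠ 0 ∧ s₅.real gain 0 0 ≤ s₅.real bestGain 0 0
  · rw [run_ite_pos (by simpa using hbest)]
    rcases ih₅ with ⟨h1, -⟩ | ⟨h1, b, hb, h2, h3, h4, h5, h6⟩
    · exact absurd h1 hbest.1
    refine .inr ⟨h1, b, hb, h2, h3, h4, h5, fun v hv hvS hc => ?_⟩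
    obtain hv | rfl := Nat.lt_succ_iff_lt_or_eq.1 hv
    · exact h6 v hv hvS hc
    · rw [← hgain, ← h5]; exact hbest.2
  · rw [run_ite_neg (by simpa using hbest)]
    refine .inr ⟨by simp [Memory.nat_setNat], u, hun, by simp [Memory.nat_setNat, hst₅], hu, hcand,
      by simp [Memory.real_setReal, hgain], fun v hv hvS hc => ?_⟩
    obtain hv | rfl := Nat.lt_succ_iff_lt_or_eq.1 hv
    · rcases ih₅ with ⟨h1, h2⟩ | ⟨h1, b, hb, h2, h3, h4, h5, h6⟩
      · exact absurd hc (h2 v hv hvS)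
      · refine (h6 v hv hvS hc).trans ?_
        rw [← h5, ← hgain]
        -- The test for keeping the old best failed although there is one, so the new gain exceeds
        -- it.
        by_contra h
        exact hbest ⟨h1, by linarith⟩
    · exact le_rfl

/-- The first alternative is the stopping condition of `Promising.le_of_maximal`, the second
supplies what `Promising.insert` needs. -/
theorem run_extend (hI : IsInstance O n M D W) (hS : HoldsSelection s n D W m r S φ)
    (hφ : IsTransversal M (vicinity (Finset.range n) D r) S φ) (hC : HoldsCover s n Cov) :
    (HoldsSelection (extend.run O s) n D W m r S φ ∧ HoldsCover (extend.run O s) n Cov ∧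
      ∀ u < n, u ∉ S → ¬ IsCandidate n M D r S u) ∨
    ∃ b < n, b ∉ S ∧ IsCandidate n M D r S b ∧
      (∀ u < n, u ∉ S → IsCandidate n M D r S u → gainOf n D W r Cov u ≤ gainOf n D W r Cov b) ∧
      ∃ ψ, HoldsSelection (extend.run O s) n D W m r (insert b S) ψ ∧
        IsTransversal M (vicinity (Finset.range n) D r) (insert b S) ψ ∧
        HoldsCover (extend.run O s) n
          (Cov ∪ coverIn (Finset.range n) D {b} (r + r + r)) := by
  have hbest := run_selectBest hI hS hφ hC
  rw [extend, run_seq]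
  have hS₁ := hS.agree (agree_run (O := O) selectBest s) (by decide) (by decide)
  have hC₁ : HoldsCover (selectBest.run O s) n Cov := hC.congr (nat_run _ _ _ (by decide))
  generalize selectBest.run O s = s₁ at *
  rcases hbest with ⟨h1, h2⟩ | ⟨h1, b, hb, h2, h3, h4, -, h6⟩
  · rw [run_ite_neg (by simpa using h1)]
    exact .inl ⟨hS₁, hC₁, h2⟩
  rw [run_ite_pos (by simpa using h1), run_seq]
  refine .inr ⟨b, hb, h3, h4, h6, ?_⟩
  set s₂ := (assign start (.var best)).run O s₁ with hs₂
  have hS₂ : HoldsSelection s₂ n D W m r S φ := hS₁.setNat (by decide) ..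
  have hst₂ : s₂.nat start 0 0 = b := by simp [hs₂, Memory.nat_setNat, h2]
  have hC₂ : HoldsCover s₂ n Cov := hC₁.congr (Memory.nat_setNat_of_ne _ (by decide) _ _ _)
  obtain ⟨ψ, hSψ, hψ⟩ := run_search_augment hI hS₂ hφ hst₂ h3 hb
    ((found_iff hI hS₂ hφ hst₂ h3 hb).2 h4)
  have hst₃ : ((search ;; augment).run O s₂).nat start 0 0 = b := by
    rw [nat_run _ _ _ (by decide)]; exact hst₂
  have hC₃ : HoldsCover ((search ;; augment).run O s₂) n Cov :=
    hC₂.congr (nat_run _ _ _ (by decide))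
  rw [run_seq, run_seq, ← run_seq search]
  generalize (search ;; augment).run O s₂ = s₃ at *
  refine ⟨ψ, hSψ.agree (agree_run (O := O) _ s₃) (by decide) (by decide), hψ, ?_, ?_⟩
  · exact Finset.union_subset hC.subset fun v hv => (mem_coverIn.1 hv).1
  intro v hv
  have key : ∀ v < n, (coverStart.run O s₃).nat covered v 0 ≠ 0 ↔ (v ∈ Cov ∨ v < n ∧ D b v ≤ r + r + r) := by
    refine run_loop (s := s₃) (fun k s' => ∀ v < n, s'.nat covered v 0 ≠ 0 ↔
      (v ∈ Cov ∨ v < k ∧ D b v ≤ r + r + r)) hSψ.size ?_ ?_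
    · intro v hv
      rw [Memory.nat_setNat_of_ne _ (by decide), hC₃.covered v hv]
      simp
    · intro k s₄ hk hck hag ih v hv
      have hd : s₄.real 0 = D := (hag.real _ (by decide)).trans hSψ.dist
      have hr : s₄.real radius 0 0 = r := by rw [hag.real _ (by decide)]; exact hSψ.radius
      have hst : s₄.nat start 0 0 = b := by rw [hag.nat _ (by decide)]; exact hst₃
      rw [Memory.nat_setNat_of_ne _ (by decide)]
      by_cases hbk : D b k ≤ r + r + r
      · rw [run_ite_pos (by simpa [hck, hd, hr, hst] using hbk)]
        by_cases hvk : v = k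
        · refine iff_of_true (by simp [Memory.nat_setNat, hck, hvk]) (.inr ⟨by omega, hvk ▸ hbk⟩)
        · have : ((store covered (.var 31) (.lit 1)).run O s₄).nat covered v 0 =
              s₄.nat covered v 0 := by simp [Memory.nat_setNat, hck, hvk]
          rw [this, ih v hv, show v < k + 1 ↔ v < k by omega]
      · rw [run_ite_neg (by simpa [hck, hd, hr, hst] using hbk)]
        refine (ih v hv).trans (or_congr_right (and_congr_left fun h => ?_))
        have : v ≠ k := fun e => hbk (e ▸ h)
        omega
  rw [key v hv]
  simp [mem_coverIn, hv]

/-! ### The greedy selection for a fixed radius. -/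

/-- `C` is a solution of radius `r`. -/
def IsSolutionIn (n : ℕ) (M : Matroid ℕ) (D : ℕ → ℕ → ℝ) (W : ℕ → ℝ) (m : ℝ) (C : Finset ℕ)
    (r : ℝ) : Prop :=
  C ⊆ Finset.range n ∧ M.Indep C ∧ m ≤ ∑ v ∈ coverIn (Finset.range n) D C r, W v

theorem run_greedy (hI : IsInstance O n M D W) (hs : HoldsInstance s n D W m)
    (hr : s.real radius 0 0 = r) (hr0 : 0 ≤ r) :
    ∃ S φ, HoldsSelection (greedy.run O s) n D W m r S φ ∧
      IsTransversal M (vicinity (Finset.range n) D r) S φ ∧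
      HoldsCover (greedy.run O s) n (coverIn (Finset.range n) D S (r + r + r)) ∧
      ((∃ C, IsSolutionIn n M D W m C r) →
        m ≤ ∑ v ∈ coverIn (Finset.range n) D S (r + r + r), W v) := by
  set V := Finset.range n with hV
  let p := clear 32 chosen ;; clear 33 covered
  set s₁ := p.run O s with hs₁
  have hi₁ : HoldsInstance s₁ n D W m := hs.agree (agree_run _ s) (by decide) (by decide)
  have hr₁ : s₁.real radius 0 0 = r := by rw [hs₁, real_run _ _ _ (by decide)]; exact hr
  have hch : ∀ i < n, s₁.nat chosen i 0 = 0 := by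
    intro i hi
    have : s₁.nat chosen = ((clear 32 chosen).run O s).nat chosen :=
      nat_run (clear 33 covered) _ _ (by decide)
    rw [this]
    exact run_clear (by decide) hs.size i hi
  have hcov : ∀ i < n, s₁.nat covered i 0 = 0 := by
    refine run_clear (by decide) ?_
    rw [nat_run (clear 32 chosen) s 0 (by decide)]; exact hs.size
  have hempty : coverIn V D ∅ (r + r + r) = ∅ := by ext; simp [mem_coverIn]
  have hunion : ∀ S b, coverIn V D (insert b S) (r + r + r) =
      coverIn V D S (r + r + r) ∪ coverIn V D {b} (r + r + r) := by
    intro S b; ext v; simp [mem_coverIn, and_or_left, or_comm]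
  -- Only the promise depends on a solution of radius `r`. The last clause records that each round
  -- adds a point unless the selection is already maximal; after `n` rounds it is maximal either
  -- way.
  suffices h : ∃ S φ, HoldsSelection (greedy.run O s) n D W m r S φ ∧
      IsTransversal M (vicinity V D r) S φ ∧
      HoldsCover (greedy.run O s) n (coverIn V D S (r + r + r)) ∧
      ((∃ C, IsSolutionIn n M D W m C r) →
        Promising V D W M r m S (coverIn V D S (r + r + r))) ∧
      (n ≤ S.card ∨ ∀ u < n, u ∉ S → ¬ IsCandidate n M D r S u) by
    obtain ⟨S, φ, h1, h2, h3, h4, h5⟩ := h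
    refine ⟨S, φ, h1, h2, h3, fun hC => (h4 hC).le_of_maximal hr0 hI.dist_self fun u hu huS => ?_⟩
    rcases h5 with h5 | h5
    · have := Finset.eq_of_subset_of_card_le h1.subset (by simpa using h5)
      exact absurd (this ▸ hu) huS
    · exact h5 u (Finset.mem_range.1 hu) huS
  refine run_loop (s := s₁) (fun k s' => ∃ S φ, HoldsSelection s' n D W m r S φ ∧
      IsTransversal M (vicinity V D r) S φ ∧
      HoldsCover s' n (coverIn V D S (r + r + r)) ∧
      ((∃ C, IsSolutionIn n M D W m C r) →
        Promising V D W M r m S (coverIn V D S (r + r + r))) ∧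
      (k ≤ S.card ∨ ∀ u < n, u ∉ S → ¬ IsCandidate n M D r S u)) hi₁.size ?_ ?_
  · refine ⟨∅, id, HoldsSelection.setNat ?_ (by decide) .., .empty id, ?_, ?_, by simp⟩
    · exact { hi₁ with
        radius := hr₁
        subset := by simp
        chosen := fun i hi => by simp [hch i hi]
        rep := by simp }
    · rw [hempty]
      refine ⟨by simp, fun i hi => ?_⟩
      rw [Memory.nat_setNat_of_ne _ (by decide)]
      simp [hcov i hi]
    · rintro ⟨C, hC, hCi, hCm⟩
      rw [hempty]
      exact promising_empty hC hCi hCm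
  · rintro k s₂ hk hck hag ⟨S, φ, h1, h2, h3, h4, h5⟩
    rcases run_extend hI h1 h2 h3 with ⟨g1, g2, g3⟩ | ⟨b, hb, hbS, hbc, hmax, ψ, g1, g2, g3⟩
    · exact ⟨S, φ, g1.setNat (by decide) .., h2,
        g2.congr (Memory.nat_setNat_of_ne _ (by decide) _ _ _), h4, .inr g3⟩
    · refine ⟨insert b S, ψ, g1.setNat (by decide) .., g2, ?_, ?_, ?_⟩
      · rw [hunion]
        exact g3.congr (Memory.nat_setNat_of_ne _ (by decide) _ _ _)
      · intro hC
        rw [hunion]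
        exact (h4 hC).insert hr0 hI.weight_nonneg hI.dist_self hI.dist_comm hI.triangle
          (Finset.mem_range.2 hb) hbS hbc h3.subset
          fun o ho hoS hoc => hmax o (Finset.mem_range.1 ho) hoS hoc
      · rw [Finset.card_insert_of_notMem hbS]
        rcases h5 with h5 | h5
        · exact .inl (by omega)
        · exact absurd hbc (h5 b hb hbS)


/-! ### Trying all radii and keeping the best result. -/

/-- The output, if there is one, is a solution. -/
def IsSound (n : ℕ) (M : Matroid ℕ) (D : ℕ → ℕ → ℝ) (W : ℕ → ℝ) (m : ℝ) (s : Memory) : Prop :=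
  s.nat 1 0 0 = 0 ∨ (s.nat 1 0 0 = 1 ∧ ∃ C, (∀ i < n, s.nat 2 i 0 ≠ 0 ↔ i ∈ C) ∧
    0 ≤ s.real 3 0 0 ∧ IsSolutionIn n M D W m C (s.real 3 0 0))

/-- If there is a solution of radius `r`, there is an output whose radius is at most `5 r`. -/
def IsGood (n : ℕ) (M : Matroid ℕ) (D : ℕ → ℕ → ℝ) (W : ℕ → ℝ) (m r : ℝ) (s : Memory) : Prop :=
  (∃ C, IsSolutionIn n M D W m C r) → s.nat 1 0 0 = 1 ∧ s.real 3 0 0 ≤ r + r + r + r + r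

theorem IsSound.congr {s s' : Memory} (h : IsSound n M D W m s) (h1 : s'.nat 1 = s.nat 1)
    (h2 : s'.nat 2 = s.nat 2) (h3 : s'.real 3 = s.real 3) : IsSound n M D W m s' := by
  rw [IsSound, h1, h2, h3]; exact h

theorem IsGood.congr {s s' : Memory} (h : IsGood n M D W m r s) (h1 : s'.nat 1 = s.nat 1)
    (h3 : s'.real 3 = s.real 3) : IsGood n M D W m r s' := by
  rw [IsGood, h1, h3]; exact h

theorem run_record (hS : HoldsSelection s n D W m r S φ) :
    (record.run O s).nat 1 0 0 = 1 ∧ (record.run O s).real 3 0 0 = r + r + r + r + r ∧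
      ∀ i < n, (record.run O s).nat 2 i 0 ≠ 0 ↔ i ∈ S.image φ := by
  let p := assign 1 (.lit 1) ;; assignReal 3 radius5
  have hS₁ : HoldsSelection (p.run O s) n D W m r S φ :=
    hS.agree (agree_run p s) (by decide) (by decide)
  have h1 : (p.run O s).nat 1 0 0 = 1 := by simp [p, Memory.nat_setNat]
  have h3 : (p.run O s).real 3 0 0 = r + r + r + r + r := by
    simp [p, Memory.real_setReal, hS.radius]
  let q := clear 36 2 ;; loop 37 (ite (nonzero (.entry chosen (.var 37)))
    (store 2 (.entry rep (.var 37)) (.lit 1)) skip)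
  have hrun : record.run O s = q.run O (p.run O s) := rfl
  rw [hrun]
  generalize p.run O s = s₁ at *
  refine ⟨by rw [nat_run _ _ _ (by decide)]; exact h1,
    by rw [real_run _ _ _ (by decide)]; exact h3, ?_⟩
  have hclear : ∀ i < n, ((clear 36 2).run O s₁).nat 2 i 0 = 0 := run_clear (by decide) hS₁.size
  have hS₂ := hS₁.agree (agree_run (O := O) (clear 36 2) s₁) (by decide) (by decide)
  have key : ∀ i < n, (q.run O s₁).nat 2 i 0 ≠ 0 ↔ ∃ t ∈ S, t < n ∧ φ t = i := by
    refine run_loop (s := (clear 36 2).run O s₁)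
      (fun k s' => ∀ i < n, s'.nat 2 i 0 ≠ 0 ↔ ∃ t ∈ S, t < k ∧ φ t = i) hS₂.size ?_ ?_
    · intro i hi
      rw [Memory.nat_setNat_of_ne _ (by decide)]
      simp [hclear i hi]
    · intro k s₃ hk hck hag ih i hi
      have hS₃ := hS₂.agree hag (by decide) (by decide)
      rw [Memory.nat_setNat_of_ne _ (by decide)]
      by_cases hkS : k ∈ S
      · rw [run_ite_pos (by simpa [hck] using (hS₃.chosen k hk).2 hkS)]
        have hrep := hS₃.rep k hkS
        by_cases hik : i = φ k
        · exact iff_of_true (by simp [Memory.nat_setNat, hck, hrep, hik])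
            ⟨k, hkS, by omega, hik.symm⟩
        · have : ((store 2 (.entry rep (.var 37)) (.lit 1)).run O s₃).nat 2 i 0 =
              s₃.nat 2 i 0 := by simp [Memory.nat_setNat, hck, hrep, hik]
          rw [this, ih i hi]
          refine exists_congr fun t => and_congr_right fun ht => ⟨fun h => ⟨by omega, h.2⟩,
            fun h => ⟨?_, h.2⟩⟩
          have : t ≠ k := fun e => hik (e ▸ h.2.symm)
          omega
      · rw [run_ite_neg (by simpa [hck] using mt (hS₃.chosen k hk).1 hkS)]
        refine (ih i hi).trans (exists_congr fun t => and_congr_right fun ht =>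
          ⟨fun h => ⟨by omega, h.2⟩, fun h => ⟨?_, h.2⟩⟩)
        have : t ≠ k := fun e => hkS (e ▸ ht)
        omega
  intro i hi
  rw [key i hi, Finset.mem_image]
  exact exists_congr fun t => and_congr_right fun ht =>
    ⟨fun h => h.2, fun h => ⟨Finset.mem_range.1 (hS.subset ht), h⟩⟩

/-- Soundness needs no solution of radius `r`, since the covered weight is compared with `m`. What
is achieved for other radii `ρ` persists because the recorded radius never increases. -/
theorem run_attempt (hI : IsInstance O n M D W) (hs : HoldsInstance s n D W m)
    (hr : s.real radius 0 0 = r) (hr0 : 0 ≤ r) (hsound : IsSound n M D W m s) :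
    IsSound n M D W m (attempt.run O s) ∧ IsGood n M D W m r (attempt.run O s) ∧
      ∀ ρ, IsGood n M D W m ρ s → IsGood n M D W m ρ (attempt.run O s) := by
  obtain ⟨S, φ, hS, hφ, hC, hm⟩ := run_greedy hI hs hr hr0
  set V := Finset.range n
  have htotal : ((sumWeights 35 total (nonzero (.entry covered (.var 35)))).run O
      (greedy.run O s)).real total 0 0 = ∑ v ∈ coverIn V D S (r + r + r), W v := by
    refine run_sumWeights (by decide) hS.size hS.weight hC.subset fun i s' hi hc hag => ?_
    have h1 : s'.nat covered = (greedy.run O s).nat covered := hag.nat _ (by decide)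
    simpa [hc, h1] using hC.covered i hi
  let p := greedy ;; sumWeights 35 total (nonzero (.entry covered (.var 35)))
  have hag := agree_run (O := O) p s
  have hS₁ : HoldsSelection (p.run O s) n D W m r S φ :=
    hS.agree (agree_run _ _) (by decide) (by decide)
  rw [attempt, run_seq, run_seq, ← run_seq greedy]
  change (p.run O s).real total 0 0 = _ at htotal
  change IsSound n M D W m (LoopProgram.run O _ (p.run O s)) ∧
    IsGood n M D W m r (LoopProgram.run O _ (p.run O s)) ∧
      ∀ ρ, IsGood n M D W m ρ s → IsGood n M D W m ρ (LoopProgram.run O _ (p.run O s))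
  have h1 : (p.run O s).nat 1 = s.nat 1 := hag.nat _ (by decide)
  have h2 : (p.run O s).nat 2 = s.nat 2 := hag.nat _ (by decide)
  have h3 : (p.run O s).real 3 = s.real 3 := hag.real _ (by decide)
  have hsound₁ := hsound.congr h1 h2 h3
  have hgood₁ : ∀ ρ, IsGood n M D W m ρ s → IsGood n M D W m ρ (p.run O s) :=
    fun ρ h => h.congr h1 h3
  generalize p.run O s = s₁ at *
  by_cases hc : m ≤ ∑ v ∈ coverIn V D S (r + r + r), W v ∧
      ¬ (s₁.nat 1 0 0 ≠ 0 ∧ s₁.real 3 0 0 ≤ r + r + r + r + r)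
  · rw [run_ite_pos (by simpa [hS₁.bound, hS₁.radius, htotal] using hc)]
    obtain ⟨g1, g3, g2⟩ := run_record (O := O) hS₁
    have hVS : S.image φ ⊆ V := fun v hv => by
      obtain ⟨t, ht, rfl⟩ := Finset.mem_image.1 hv
      exact (hφ.mem t ht).1
    refine ⟨.inr ⟨g1, S.image φ, g2, by rw [g3]; positivity, hVS, by simpa using hφ.indep, ?_⟩,
      fun _ => ⟨g1, g3.le⟩, fun ρ hρ hsol => ⟨g1, ?_⟩⟩
    · rw [g3]
      exact hc.1.trans (Finset.sum_le_sum_of_subset_of_nonneg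
        (coverIn_subset_image hS.subset hI.dist_comm hI.triangle hφ)
        fun v hv _ => hI.weight_nonneg v (mem_coverIn.1 hv).1)
    · obtain ⟨k1, k3⟩ := hgood₁ ρ hρ hsol
      rw [g3]
      by_contra h
      exact hc.2 ⟨by omega, by linarith⟩
  · rw [run_ite_neg (by simpa [hS₁.bound, hS₁.radius, htotal] using hc)]
    refine ⟨hsound₁, fun hsol => ?_, hgood₁⟩
    obtain ⟨k1, k3⟩ := not_not.1 (not_and.1 hc (hm hsol))
    rcases hsound₁ with h | h
    · exact absurd h k1
    · exact ⟨h.1, k3⟩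

theorem run_main (hI : IsInstance O n M D W) (hs : HoldsInstance s n D W m)
    (hr : s.real radius 0 0 = 0) (hflag : s.nat 1 0 0 = 0) :
    IsSound n M D W m (main.run O s) ∧ IsGood n M D W m 0 (main.run O s) ∧
      ∀ i < n, ∀ j < n, IsGood n M D W m (D i j) (main.run O s) := by
  obtain ⟨h1, h2, -⟩ := run_attempt hI hs hr le_rfl (.inl hflag)
  have hs₁ : HoldsInstance (attempt.run O s) n D W m :=
    hs.agree (agree_run attempt s) (by decide) (by decide)
  -- Nonnegativity follows from the triangle inequality `D i i ≤ D i j + D j i` and symmetry.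
  have hD0 : ∀ i < n, ∀ j < n, 0 ≤ D i j := by
    intro i hi j hj
    have hi := Finset.mem_range.2 hi
    have hj := Finset.mem_range.2 hj
    have h1 := hI.triangle i hi j hj i hi
    rw [hI.dist_self i hi, ← hI.dist_comm i hi j hj] at h1
    linarith
  rw [main, run_seq]
  generalize attempt.run O s = s₁ at *
  refine run_loop (s := s₁) (fun k s' => IsSound n M D W m s' ∧ IsGood n M D W m 0 s' ∧
      ∀ i < k, ∀ j < n, IsGood n M D W m (D i j) s') hs₁.size
    ⟨h1.congr rfl rfl rfl, h2.congr rfl rfl, fun i hi => absurd hi (by omega)⟩ ?_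
  intro i s₂ hi hci hag ⟨ih1, ih2, ih3⟩
  have hs₂ := hs₁.agree hag (by decide) (by decide)
  set body := assignReal radius (distance (.var 38) (.var 39)) ;; attempt with hbody
  have key : IsSound n M D W m ((loop 39 body).run O s₂) ∧
      IsGood n M D W m 0 ((loop 39 body).run O s₂) ∧
      (∀ i' < i, ∀ j < n, IsGood n M D W m (D i' j) ((loop 39 body).run O s₂)) ∧
      ∀ j < n, IsGood n M D W m (D i j) ((loop 39 body).run O s₂) := by
    refine run_loop (s := s₂) (fun k s' => IsSound n M D W m s' ∧ IsGood n M D W m 0 s' ∧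
      (∀ i' < i, ∀ j < n, IsGood n M D W m (D i' j) s') ∧
      ∀ j < k, IsGood n M D W m (D i j) s') hs₂.size
      ⟨ih1.congr rfl rfl rfl, ih2.congr rfl rfl, fun i' hi' j hj => (ih3 i' hi' j hj).congr rfl rfl,
        fun j hj => absurd hj (by omega)⟩ ?_
    intro j s₃ hj hcj hag₃ ⟨k1, k2, k3, k4⟩
    have hs₃ := hs₂.agree hag₃ (by decide) (by decide)
    have hci₃ : s₃.nat 38 0 0 = i := by rw [hag₃.nat _ (by decide)]; exact hci
    rw [hbody, run_seq]
    set s₄ := (assignReal radius (distance (.var 38) (.var 39))).run O s₃ with hs₄def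
    have hs₄ : HoldsInstance s₄ n D W m := hs₃.agree (agree_run _ s₃) (by decide) (by decide)
    have hr₄ : s₄.real radius 0 0 = D i j := by
      simp [hs₄def, Memory.real_setReal, hci₃, hcj, hs₃.dist]
    have hreal : s₄.real 3 = s₃.real 3 := Memory.real_setReal_of_ne _ (by decide) _ _ _
    obtain ⟨g1, g2, g3⟩ := run_attempt hI hs₄ hr₄ (hD0 i hi j hj) (k1.congr rfl rfl hreal)
    have hmono : ∀ ρ, IsGood n M D W m ρ s₃ →
        IsGood n M D W m ρ ((attempt.run O s₄).setNat 39 0 0 (j + 1)) :=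
      fun ρ h => (g3 ρ (h.congr rfl hreal)).congr rfl rfl
    refine ⟨g1.congr rfl rfl rfl, hmono _ k2, fun i' hi' j' hj' => hmono _ (k3 i' hi' j' hj'),
      fun j' hj' => ?_⟩
    obtain hj' | rfl := Nat.lt_succ_iff_lt_or_eq.1 hj'
    · exact hmono _ (k4 j' hj')
    · exact g2.congr rfl rfl
  refine ⟨key.1.congr rfl rfl rfl, key.2.1.congr rfl rfl, fun i' hi' j hj => ?_⟩
  obtain hi' | rfl := Nat.lt_succ_iff_lt_or_eq.1 hi'
  · exact (key.2.2.1 i' hi' j hj).congr rfl rfl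
  · exact (key.2.2.2 j hj).congr rfl rfl

end LoopProgram

/-! ### Transfer between the metric space and its indices. -/

namespace RobustMatroidCenter

variable {X : Type*} {n : ℕ}

/-- The index of a point. -/
def index (e : Fin n ≃ X) : X ↪ ℕ := e.symm.toEmbedding.trans Fin.valEmbedding

theorem index_lt (e : Fin n ≃ X) (x : X) : index e x < n := (e.symm x).2

theorem index_apply (e : Fin n ≃ X) (i : Fin n) : index e (e i) = i := by simp [index]

theorem exists_index_eq (e : Fin n ≃ X) {i : ℕ} (hi : i < n) : ∃ x, index e x = i :=
  ⟨e ⟨i, hi⟩, index_apply e _⟩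

variable [MetricSpace X]

/-- The distances of the indices. -/
noncomputable def indexDist (e : Fin n ≃ X) (i j : ℕ) : ℝ :=
  if h : i < n ∧ j < n then dist (e ⟨i, h.1⟩) (e ⟨j, h.2⟩) else 0

theorem indexDist_index (e : Fin n ≃ X) (x y : X) :
    indexDist e (index e x) (index e y) = dist x y := by
  simp [indexDist, index]

variable [Fintype X]

/-- The matroid on the indices. -/
def indexMatroid (I : RobustMatroidCenter X) (e : Fin n ≃ X) : Matroid ℕ :=
  I.M.mapEmbedding (index e)

theorem indexMatroid_indep_image (I : RobustMatroidCenter X) (e : Fin n ≃ X) (C : Set X) :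
    (I.indexMatroid e).Indep (index e '' C) ↔ I.M.Indep C := by
  rw [indexMatroid, Matroid.mapEmbedding_indep_iff, Set.preimage_image_eq _ (index e).injective]
  simp

/-- The weights of the indices. -/
noncomputable def indexWeight (I : RobustMatroidCenter X) (e : Fin n ≃ X) (i : ℕ) : ℝ :=
  if h : i < n then I.w (e ⟨i, h⟩) else 0

theorem indexWeight_index (I : RobustMatroidCenter X) (e : Fin n ≃ X) (x : X) :
    indexWeight I e (index e x) = I.w x := by
  simp [indexWeight, index]

theorem isInstance (I : RobustMatroidCenter X) (e : Fin n ≃ X) :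
    IsInstance (I.oracle e) n (I.indexMatroid e) (indexDist e) (I.indexWeight e) := by
  have hex : ∀ i ∈ Finset.range n, ∃ x, index e x = i := fun i hi =>
    exists_index_eq e (Finset.mem_range.1 hi)
  refine ⟨fun A => ?_, ?_, ?_, ?_, ?_, ?_⟩
  · have : A ∩ Set.Iio n = index e '' {x | (e.symm x : ℕ) ∈ A} := by
      ext i
      constructor
      · rintro ⟨hA, hi⟩
        obtain ⟨x, rfl⟩ := exists_index_eq e hi
        exact ⟨x, hA, rfl⟩
      · rintro ⟨x, hx, rfl⟩
        exact ⟨hx, index_lt e x⟩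
    rw [this, indexMatroid_indep_image]
    rfl
  · ext i
    simp only [indexMatroid, Matroid.mapEmbedding_ground_eq, I.ground_eq, Set.image_univ,
      Set.mem_range, Set.mem_Iio]
    exact ⟨fun ⟨x, hx⟩ => hx ▸ index_lt e x, exists_index_eq e⟩
  · intro v hv
    obtain ⟨x, rfl⟩ := hex v hv
    rw [indexWeight_index]; positivity
  · intro x hx
    obtain ⟨x, rfl⟩ := hex x hx
    rw [indexDist_index, dist_self]
  · intro x hx y hy
    obtain ⟨x, rfl⟩ := hex x hx
    obtain ⟨y, rfl⟩ := hex y hy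
    rw [indexDist_index, indexDist_index, dist_comm]
  · intro x hx y hy z hz
    obtain ⟨x, rfl⟩ := hex x hx
    obtain ⟨y, rfl⟩ := hex y hy
    obtain ⟨z, rfl⟩ := hex z hz
    simp only [indexDist_index]
    exact dist_triangle x y z

theorem holdsInstance (I : RobustMatroidCenter X) (e : Fin n ≃ X) :
    HoldsInstance (I.input e) n (indexDist e) (I.indexWeight e) I.m :=
  ⟨rfl, rfl, fun _ => rfl, rfl⟩

theorem weight_cover_eq (I : RobustMatroidCenter X) (e : Fin n ≃ X) {C : Set X} {C' : Finset ℕ}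
    (hC : (C' : Set ℕ) = index e '' C) (r : ℝ) :
    ∑ v ∈ coverIn (Finset.range n) (indexDist e) C' r, I.indexWeight e v =
      I.weight (cover C r) := by
  classical
  have hmem : ∀ u, u ∈ C' ↔ ∃ x ∈ C, index e x = u := fun u => by
    rw [← Finset.mem_coe, hC]; rfl
  have hset : coverIn (Finset.range n) (indexDist e) C' r =
      (Finset.univ.filter fun x => x ∈ cover C r).map (index e) := by
    ext v
    simp only [mem_coverIn, Finset.mem_map, Finset.mem_filter, Finset.mem_univ, true_and, cover,
      Set.mem_iUnion, Metric.mem_closedBall, Finset.mem_range, hmem]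
    constructor
    · rintro ⟨hv, _, ⟨x, hx, rfl⟩, hd⟩
      obtain ⟨y, rfl⟩ := exists_index_eq e hv
      rw [indexDist_index] at hd
      exact ⟨y, ⟨x, hx, by rwa [dist_comm]⟩, rfl⟩
    · rintro ⟨y, ⟨x, hx, hd⟩, rfl⟩
      exact ⟨index_lt e y, _, ⟨x, hx, rfl⟩, by rwa [indexDist_index, dist_comm]⟩
  rw [hset, Finset.sum_map, weight, NNReal.coe_sum, Finset.sum_filter]
  refine Finset.sum_congr rfl fun x _ => ?_
  by_cases hx : x ∈ cover C r <;> simp [hx, indexWeight_index]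

theorem isSolutionIn_iff (I : RobustMatroidCenter X) (e : Fin n ≃ X) {C : Set X} {C' : Finset ℕ}
    (hC : (C' : Set ℕ) = index e '' C) {r : ℝ} (hr : 0 ≤ r) :
    LoopProgram.IsSolutionIn n (I.indexMatroid e) (indexDist e) (I.indexWeight e) I.m C' r ↔
      I.IsSolution C r := by
  have hsub : C' ⊆ Finset.range n := fun v hv => by
    rw [← Finset.mem_coe, hC] at hv
    obtain ⟨x, -, rfl⟩ := hv
    exact Finset.mem_range.2 (index_lt e x)
  rw [LoopProgram.IsSolutionIn, IsSolution, weight_cover_eq I e hC, hC, indexMatroid_indep_image,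
    NNReal.coe_le_coe]
  simp [hsub, hr]

/-- Every cover is a cover for a radius that is zero or a distance of two points. -/
theorem exists_dist_cover_eq (C : Set X) {r : ℝ} (hr : 0 ≤ r) :
    ∃ ρ, 0 ≤ ρ ∧ ρ ≤ r ∧ (ρ = 0 ∨ ∃ x y : X, ρ = dist x y) ∧ cover C ρ = cover C r := by
  classical
  -- The radius is rounded down to the largest of zero and the distances not exceeding `r`.
  let T : Finset ℝ := insert 0 ((Finset.univ.image fun p : X × X => dist p.1 p.2).filter (· ≤ r))
  have hT : T.Nonempty := ⟨0, Finset.mem_insert_self ..⟩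
  have hmem := T.max'_mem hT
  have hle : T.max' hT ≤ r := by
    obtain h | h := Finset.mem_insert.1 hmem
    · rw [h]; exact hr
    · exact (Finset.mem_filter.1 h).2
  refine ⟨T.max' hT, T.le_max' 0 (Finset.mem_insert_self ..), hle, ?_, ?_⟩
  · obtain h | h := Finset.mem_insert.1 hmem
    · exact .inl h
    · obtain ⟨p, -, hp⟩ := Finset.mem_image.1 (Finset.mem_filter.1 h).1
      exact .inr ⟨p.1, p.2, hp.symm⟩
  · ext v
    simp only [cover, Set.mem_iUnion, Metric.mem_closedBall]
    refine exists_congr fun u => exists_congr fun _ => ⟨fun h => h.trans hle, fun h => ?_⟩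
    refine T.le_max' _ (Finset.mem_insert_of_mem (Finset.mem_filter.2 ⟨?_, h⟩))
    exact Finset.mem_image.2 ⟨(v, u), Finset.mem_univ _, rfl⟩

/-- The final memory of the algorithm holds an approximate answer. -/
theorem isApproxAnswer_run_main (I : RobustMatroidCenter X) (e : Fin n ≃ X) :
    I.IsApproxAnswer 5 e (LoopProgram.main.run (I.oracle e) (I.input e)) := by
  obtain ⟨hsound, hzero, hgood⟩ :=
    LoopProgram.run_main (I.isInstance e) (I.holdsInstance e) rfl rfl
  generalize LoopProgram.main.run (I.oracle e) (I.input e) = s at *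
  have happrox : ∀ C r, I.IsSolution C r → outFlag s = 1 ∧ outRadius s ≤ 5 * r := by
    rintro C r ⟨hr, hCi, hCm⟩
    -- `C` is also a solution for the rounded radius `ρ ≤ r`, which is one of the radii tried, so
    -- the output has radius at most `5ρ ≤ 5r`.
    obtain ⟨ρ, hρ0, hρr, hρ, hcov⟩ := exists_dist_cover_eq C hr
    have hfin : (index e '' C).Finite := Set.toFinite _
    have hsol := (isSolutionIn_iff I e (C' := hfin.toFinset) (by simp) hρ0).2
      ⟨hρ0, hCi, by rw [hcov]; exact hCm⟩
    have : LoopProgram.IsGood n (I.indexMatroid e) (indexDist e) (I.indexWeight e) I.m ρ s := by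
      rcases hρ with rfl | ⟨x, y, rfl⟩
      · exact hzero
      · rw [← indexDist_index e]
        exact hgood _ (index_lt e x) _ (index_lt e y)
    obtain ⟨h1, h3⟩ := this ⟨_, hsol⟩
    refine ⟨h1, ?_⟩
    change s.real 3 0 0 ≤ 5 * r
    linarith
  have hout : outFlag s ≠ 0 → I.IsSolution (outCenters e s) (outRadius s) := by
    intro h0
    rcases hsound with h | ⟨-, C, hC, hr, hsol⟩
    · exact absurd h h0
    refine (isSolutionIn_iff I e ?_ hr).1 hsol
    ext i
    constructor
    · intro hi
      have hin := Finset.mem_range.1 (hsol.1 hi)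
      obtain ⟨x, rfl⟩ := exists_index_eq e hin
      exact ⟨x, (hC _ hin).2 hi, rfl⟩
    · rintro ⟨x, hx, rfl⟩
      exact (hC _ (index_lt e x)).1 hx
  refine ⟨fun ⟨C, r, h⟩ => ?_, fun h => ?_⟩
  · have h1 := (happrox C r h).1
    exact ⟨h1, hout (by omega), fun C' r' h' => (happrox C' r' h').2⟩
  -- A nonzero flag would come with a solution, by soundness.
  · by_contra h0
    exact h ⟨_, _, hout h0⟩

end RobustMatroidCenter

theorem theorem1 :
    ∃ (P : Program) (q : Polynomial ℕ),
      ∀ (X : Type*) [Fintype X] [MetricSpace X] (I : RobustMatroidCenter X)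
        (n : ℕ) (e : Fin n ≃ X),
        ∃ (s : Memory) (t : ℕ),
          Exec (I.oracle e) P (I.input e) s t ∧ t ≤ q.eval n ∧ I.IsApproxAnswer 5 e s := by
  refine ⟨LoopProgram.main.compile, LoopProgram.main.bound, fun X _ _ I n e => ?_⟩
  obtain ⟨t, ht, hexec⟩ := LoopProgram.exec_compile (O := I.oracle e) LoopProgram.main
    LoopProgram.wellFormed_main LoopProgram.zero_notMem_natWrites_main (I.input e)
  exact ⟨_, t, hexec, ht, I.isApproxAnswer_run_main e⟩
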